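/- **Laakso spaces.** Let $M\ge 2$ be an integer, $\theta\in(0,1/4]$, and let $(N_n)_{n\ge1}$ be even integers $\ge 4$ such that for some $C\ge 1$ one has $C^{-1}\theta^n\le\prod_{i=1}^n N_i^{-1}\le C\theta^n$ for all $n\ge 1$. Put $\delta_i:=\frac1{N_1\cdots N_i}$ and $[M]:=\{1,\dots,M\}$. Metrise $[M]^{\mathbb N}$ by letting the distance of two distinct sequences be $\theta^n$, where $n$ is the first index at which they differ, and let $\tilde X:=[0,1]\times[M]^{\mathbb N}$ carry the product metric, with first projection $h$ (the height). For $i\ge1$ let $$W_i:=\Big\{\sum_{j=1}^i t_j\delta_j:\ t_j\in\mathbb Z,\ 0\le t_j<N_j\ (j<i),\ 1\le t_i<N_i\Big\}.$$ Identify $x,y\in\tilde X$ if $x=y$, or if for some $i$ one has $h(x)=h(y)\in W_i$ and the digit sequences of $x,y$ agree except possibly in the $i$-th digit. Let $q\colon\tilde X\to X$ be the quotient map; $h$ descends to $X$. The space $X$ with the distance $$d(x,y):=\inf\{\mathcal H^1(\gamma):\ \gamma \text{ a (not necessarily continuous) curve in }\tilde X\text{ such that } q\circ\gamma\text{ is a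 continuous curve from }x\text{ to }y\}$$ ($\mathcal H^1(\gamma)$ being the Hausdorff $1$-measure of the image of $\gamma$) is a Laakso space. **Shortcuts.** For $i\ge 1$ let $$J_i:=\Big\{\sum_{j=1}^i t_j\delta_j+\tfrac{\delta_i}{2}:\ t_j\in\mathbb Z,\ 0\le t_j<N_j\ (j<i),\ 1\le t_i<N_i-1\Big\}$$ and $\mathcal J_i:=\{q(\{t\}\times\{a\}\times[M]\times\{1\}^{\mathbb N}): t\in J_i,\ a\in[M]^{i-1}\}$. Given $\eta=(\eta_i)_{i\ge1}\subseteq(0,1]$, let $\rho_\eta(x,y):=\eta_i d(x,y)$ if $x,y\in S$ for some $S\in\mathcal J_i$, and $\rho_\eta(x,y):=d(x,y)$ otherwise, and $$d_\eta(x,y):=\inf\Big\{\sum_{i=1}^n\rho_\eta(x_{i-1},x_i):\ n\ge1,\ x_0=x,\ x_n=y\Big\}.$$ The space $(X,d_\eta)$ is called a shortcut Laakso space. **Dimensions.** For a metric space $Z$ let $\dim_T Z$ be its topological (Lebesgue covering) dimension. Let $\dim_N Z$ be its Nagata dimension, i.e. the least $n\ge0$ for which there is $c>0$ such that for every $s>0$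 the space $Z$ has a cover by sets of diameter at most $cs$ such that every set of diameter at most $s$ meets at most $n+1$ of its members. A map $f\colon Z\to Y$ of metric spaces is Lipschitz light if for some $C\in(0,\infty)$ it is $C$-Lipschitz and, for all $E\subseteq Y$ and $r\in(0,\infty)$ with $r\ge\operatorname{diam}E$, the $r$-components of $f^{-1}(E)$ (the classes of points joined by finite chains in $f^{-1}(E)$ with steps of length at most $r$) have diameter at most $Cr$. The Lipschitz dimension $\dim_L Z$ is the least $n\ge0$ for which there is a Lipschitz light map $Z\to\mathbb R^n$. **Statement.** Let $(X,d_\eta)$ be a shortcut Laakso space. Then $d_\eta$ is a distance on $X$, $$\dim_T(X,d_\eta)=\dim_N(X,d_\eta)=\dim_L(X,d_\eta)=1,$$ and the height map $h\colon(X,d_\eta)\to\mathbb R$ is Lipschitz light. -/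

import Mathlib

open scoped ENNReal

noncomputable section

/-! ### Dimensions of metric spaces -/

/-- Topological (Lebesgue covering) dimension: the least `n` such that every open cover has an
open refinement in which every point lies in at most `n + 1` members (`⊤` if there is none). -/
def topologicalDim (X : Type*) [TopologicalSpace X] : ℕ∞ :=
  sInf {m : ℕ∞ | ∃ n : ℕ, m = n ∧
    ∀ U : Set (Set X), (∀ A ∈ U, IsOpen A) → ⋃₀ U = Set.univ →
      ∃ V : Set (Set X), (∀ B ∈ V, IsOpen B) ∧ ⋃₀ V = Set.univ ∧
        (∀ B ∈ V, ∃ A ∈ U, B ⊆ A) ∧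
        ∀ x : X, {B ∈ V | x ∈ B}.encard ≤ (n : ℕ∞) + 1}

/-- Nagata dimension: the least `n` for which there is `c > 0` such that for every `s > 0` the
space has a cover by sets of diameter at most `c * s` with `s`-multiplicity at most `n + 1`, i.e.
every set of diameter at most `s` meets at most `n + 1` members of the cover. -/
def nagataDim (X : Type*) [PseudoMetricSpace X] : ℕ∞ :=
  sInf {m : ℕ∞ | ∃ n : ℕ, m = n ∧
    ∃ c : ℝ, 0 < c ∧ ∀ s : ℝ, 0 < s →
      ∃ V : Set (Set X), ⋃₀ V = Set.univ ∧
        (∀ B ∈ V, Metric.ediam B ≤ ENNReal.ofReal (c * s)) ∧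
        ∀ A : Set X, Metric.ediam A ≤ ENNReal.ofReal s →
          {B ∈ V | (B ∩ A).Nonempty}.encard ≤ (n : ℕ∞) + 1}

/-- The `r`-component of `x` in the subset `A`: the points that can be reached from `x` by an
`r`-chain contained in `A`. -/
def rComponent {X : Type*} [PseudoMetricSpace X] (A : Set X) (r : ℝ) (x : X) : Set X :=
  {y | ∃ (n : ℕ) (c : ℕ → X), c 0 = x ∧ c n = y ∧ (∀ i ≤ n, c i ∈ A) ∧
    ∀ i < n, dist (c i) (c (i + 1)) ≤ r}

/-- `C`-Lipschitz light maps. -/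
def IsLipschitzLightWith {X Y : Type*} [PseudoMetricSpace X] [PseudoMetricSpace Y]
    (C : ℝ) (f : X → Y) : Prop :=
  (∀ x y, dist (f x) (f y) ≤ C * dist x y) ∧
  ∀ (E : Set Y) (r : ℝ), 0 < r → Metric.ediam E ≤ ENNReal.ofReal r →
    ∀ x ∈ f ⁻¹' E, Metric.ediam (rComponent (f ⁻¹' E) r x) ≤ ENNReal.ofReal (C * r)

/-- Lipschitz light maps. -/
def IsLipschitzLight {X Y : Type*} [PseudoMetricSpace X] [PseudoMetricSpace Y]
    (f : X → Y) : Prop :=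
  ∃ C : ℝ, 0 < C ∧ IsLipschitzLightWith C f

/-- Lipschitz dimension: the least `n` for which there is a Lipschitz light map to Euclidean
`n`-space (`⊤` if there is none). -/
def lipschitzDim (X : Type*) [PseudoMetricSpace X] : ℕ∞ :=
  sInf {m : ℕ∞ | ∃ n : ℕ, m = n ∧
    ∃ f : X → EuclideanSpace ℝ (Fin n), IsLipschitzLight f}

/-! ### Laakso spaces

Levels are numbered from `0` here: index `i` stands for level `i + 1`, so `N i` is `N_{i+1}`, and
the digits of a point form a function on `ℕ`. The alphabet `{1, …, M}` is `Fin M`, whose element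
`0` plays the role of the letter `1`. -/

/-- The parameters `M`, `θ`, `(N_n)` of a Laakso space. -/
structure LaaksoData where
  M : ℕ
  two_le_M : 2 ≤ M
  θ : ℝ
  θ_pos : 0 < θ
  θ_le : θ ≤ 1 / 4
  N : ℕ → ℕ
  N_even : ∀ i, Even (N i)
  four_le_N : ∀ i, 4 ≤ N i
  comparable : ∃ C : ℝ, 0 < C ∧ ∀ n : ℕ,
    (∏ i ∈ Finset.range n, 1 / (N i : ℝ)) ≤ C * θ ^ n ∧
      θ ^ n ≤ C * ∏ i ∈ Finset.range n, 1 / (N i : ℝ)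

namespace LaaksoData

variable (P : LaaksoData)

/-- `scale i = 1 / (N 0 * ⋯ * N i)`. -/
def scale (i : ℕ) : ℝ := 1 / ∏ j ∈ Finset.range (i + 1), (P.N j : ℝ)

/-- The first letter of the alphabet. -/
def letterOne : Fin P.M := ⟨0, lt_of_lt_of_le Nat.zero_lt_two P.two_le_M⟩

/-- The space of digit sequences. -/
def Digits : Type := ℕ → Fin P.M

open Classical in
/-- Two different sequences whose first difference is at index `n` (at level `n + 1`) have
distance `θ ^ (n + 1)`. -/
instance : MetricSpace P.Digits where
  dist x y := if x = y then 0 else P.θ ^ (PiNat.firstDiff (E := fun _ => Fin P.M) x y + 1)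
  dist_self x := by simp
  dist_comm x y := by
    simp only [eq_comm (a := x) (b := y), PiNat.firstDiff_comm (E := fun _ => Fin P.M) x y]
  dist_triangle x y z := by
    have h0 : ∀ n : ℕ, 0 ≤ P.θ ^ n := fun n => pow_nonneg P.θ_pos.le n
    have h1 : P.θ ≤ 1 := P.θ_le.trans (by norm_num)
    by_cases hxz : x = z
    · simp only [hxz, if_true]
      refine add_nonneg ?_ ?_ <;> split_ifs <;> first | exact h0 _ | exact le_rfl
    by_cases hxy : x = y
    · simp [hxy]
    by_cases hyz : y = z
    · simp [hyz]
    simp only [hxz, hxy, hyz, if_false]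
    have h := PiNat.min_firstDiff_le (E := fun _ => Fin P.M) x y z hxz
    rcases min_le_iff.1 h with h | h
    · exact (pow_le_pow_of_le_one P.θ_pos.le h1 (Nat.succ_le_succ h)).trans
        (le_add_of_nonneg_right (h0 _))
    · exact (pow_le_pow_of_le_one P.θ_pos.le h1 (Nat.succ_le_succ h)).trans
        (le_add_of_nonneg_left (h0 _))
  eq_of_dist_eq_zero := by
    intro x y h
    by_contra hne
    have h' : (if x = y then (0 : ℝ) else
      P.θ ^ (PiNat.firstDiff (E := fun _ => Fin P.M) x y + 1)) = 0 := h
    rw [if_neg hne] at h'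
    exact (pow_pos P.θ_pos _).ne' h'

instance : MeasurableSpace P.Digits := borel P.Digits

instance : BorelSpace P.Digits := ⟨rfl⟩

/-- The product `[0,1] × [M]^ℕ`, with the product metric. -/
abbrev Cover : Type := unitInterval × P.Digits

/-- The wormhole heights of index `i`. -/
def wormholeHeights (i : ℕ) : Set ℝ :=
  {s | ∃ t : ℕ → ℕ, (∀ j < i, t j < P.N j) ∧ 1 ≤ t i ∧ t i < P.N i ∧
    s = ∑ j ∈ Finset.range (i + 1), (t j : ℝ) * P.scale j}

/-- Identification of points of `[0,1] × [M]^ℕ`. As the sets of wormhole heights of different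
levels are disjoint, this is an equivalence relation. -/
def Rel (x y : P.Cover) : Prop :=
  x = y ∨ ∃ i : ℕ, x.1 = y.1 ∧ (x.1 : ℝ) ∈ P.wormholeHeights i ∧ ∀ j, j ≠ i → x.2 j = y.2 j

/-- The Laakso space as a topological space, with the quotient topology. -/
abbrev Space : Type := Quot P.Rel

/-- The quotient map. -/
def proj (x : P.Cover) : P.Space := Quot.mk P.Rel x

/-- The height. -/
def height : P.Space → ℝ :=
  Quot.lift (fun x => (x.1 : ℝ)) (by
    rintro x y (h | ⟨i, h, -⟩)
    · rw [h]
    · exact congrArg Subtype.val h)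

/-- The Laakso distance: the infimum of `ℋ¹(γ)` over the (possibly discontinuous) curves `γ` in
`[0,1] × [M]^ℕ` whose projection is a continuous curve from `x` to `y`. -/
def laaksoDist (x y : P.Space) : ℝ :=
  (⨅ (γ : unitInterval → P.Cover) (_ : Continuous (P.proj ∘ γ) ∧ P.proj (γ 0) = x ∧
    P.proj (γ 1) = y), MeasureTheory.Measure.hausdorffMeasure 1 (Set.range γ) : ℝ≥0∞).toReal

/-! ### Shortcuts -/

/-- The heights of the shortcuts of index `i`. -/
def shortcutHeights (i : ℕ) : Set ℝ :=
  {s | ∃ t : ℕ → ℕ, (∀ j < i, t j < P.N j) ∧ 1 ≤ t i ∧ t i + 1 < P.N i ∧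
    s = (∑ j ∈ Finset.range (i + 1), (t j : ℝ) * P.scale j) + P.scale i / 2}

/-- The shortcuts of index `i`: the images of the sets `{t} × {a} × [M] × {1}^ℕ` with `t` a
shortcut height and `a` a word in the digits of index `< i`. -/
def shortcuts (i : ℕ) : Set (Set P.Space) :=
  {S | ∃ t ∈ P.shortcutHeights i, ∃ a : ℕ → Fin P.M,
    S = P.proj '' {x | (x.1 : ℝ) = t ∧ (∀ j < i, x.2 j = a j) ∧ ∀ j > i, x.2 j = P.letterOne}}

open Classical in
/-- The cost `ρ_η` of a jump. Shortcuts are pairwise disjoint, so the index found is the only one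
for which `x` and `y` lie in a common shortcut. -/
def jumpCost (η : ℕ → Set.Ioc (0 : ℝ) 1) (x y : P.Space) : ℝ :=
  if h : ∃ i, ∃ S ∈ P.shortcuts i, x ∈ S ∧ y ∈ S then
    (η (Nat.find h) : ℝ) * P.laaksoDist x y
  else P.laaksoDist x y

/-- The shortcut distance `d_η`: the infimum of the total costs of chains from `x` to `y`. -/
def shortcutDist (η : ℕ → Set.Ioc (0 : ℝ) 1) (x y : P.Space) : ℝ :=
  sInf {s : ℝ | ∃ (n : ℕ) (c : ℕ → P.Space), 1 ≤ n ∧ c 0 = x ∧ c n = y ∧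
    s = ∑ i ∈ Finset.range n, P.jumpCost η (c i) (c (i + 1))}

theorem laaksoDist_self (x : P.Space) : P.laaksoDist x x = 0 := by
  obtain ⟨x, rfl⟩ := Quot.exists_rep x
  have : (⨅ (γ : unitInterval → P.Cover) (_ : Continuous (P.proj ∘ γ) ∧
      P.proj (γ 0) = P.proj x ∧ P.proj (γ 1) = P.proj x),
      MeasureTheory.Measure.hausdorffMeasure 1 (Set.range γ) : ℝ≥0∞) ≤ 0 := by
    refine iInf₂_le_of_le (fun _ => x) ⟨continuous_const, rfl, rfl⟩ ?_
    rw [Set.range_const]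
    have := MeasureTheory.Measure.nullSingletonClass_hausdorff P.Cover (zero_lt_one (α := ℝ))
    exact (MeasureTheory.measure_singleton x).le
  change ENNReal.toReal _ = 0
  rw [show (⨅ (γ : unitInterval → P.Cover) (_ : Continuous (P.proj ∘ γ) ∧
      P.proj (γ 0) = Quot.mk P.Rel x ∧ P.proj (γ 1) = Quot.mk P.Rel x),
      MeasureTheory.Measure.hausdorffMeasure 1 (Set.range γ) : ℝ≥0∞) = 0
    from le_antisymm this bot_le]
  rfl

theorem laaksoDist_comm (x y : P.Space) : P.laaksoDist x y = P.laaksoDist y x := by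
  have key : ∀ x y : P.Space,
      (⨅ (γ : unitInterval → P.Cover) (_ : Continuous (P.proj ∘ γ) ∧ P.proj (γ 0) = x ∧
        P.proj (γ 1) = y), MeasureTheory.Measure.hausdorffMeasure 1 (Set.range γ) : ℝ≥0∞) ≤
      ⨅ (γ : unitInterval → P.Cover) (_ : Continuous (P.proj ∘ γ) ∧ P.proj (γ 0) = y ∧
        P.proj (γ 1) = x), MeasureTheory.Measure.hausdorffMeasure 1 (Set.range γ) := by
    intro x y
    refine le_iInf₂ fun γ hγ => iInf₂_le_of_le (γ ∘ unitInterval.symm) ⟨?_, ?_, ?_⟩ ?_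
    · exact hγ.1.comp unitInterval.continuous_symm
    · simpa using hγ.2.2
    · simpa using hγ.2.1
    · exact MeasureTheory.measure_mono (Set.range_comp_subset_range _ _)
  exact congrArg ENNReal.toReal (le_antisymm (key x y) (key y x))

variable (η : ℕ → Set.Ioc (0 : ℝ) 1)

theorem jumpCost_nonneg (x y : P.Space) : 0 ≤ P.jumpCost η x y := by
  unfold jumpCost
  split_ifs with h
  · exact mul_nonneg (η _).2.1.le ENNReal.toReal_nonneg
  · exact ENNReal.toReal_nonneg

theorem jumpCost_self (x : P.Space) : P.jumpCost η x x = 0 := by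
  simp [jumpCost, laaksoDist_self]

theorem jumpCost_comm (x y : P.Space) : P.jumpCost η x y = P.jumpCost η y x := by
  classical
  have key : ∀ p q : ℕ → Prop, p = q → ∀ a : ℝ,
      (if h : ∃ i, p i then (η (Nat.find h) : ℝ) * a else a) =
        if h : ∃ i, q i then (η (Nat.find h) : ℝ) * a else a := by
    rintro p q rfl a
    rfl
  have := key (fun i => ∃ S ∈ P.shortcuts i, x ∈ S ∧ y ∈ S)
    (fun i => ∃ S ∈ P.shortcuts i, y ∈ S ∧ x ∈ S)
    (by simp only [and_comm (a := x ∈ _)]) (P.laaksoDist x y)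
  unfold jumpCost
  rw [← P.laaksoDist_comm x y]
  convert this

theorem shortcutDist_bddBelow (x y : P.Space) :
    BddBelow {s : ℝ | ∃ (n : ℕ) (c : ℕ → P.Space), 1 ≤ n ∧ c 0 = x ∧ c n = y ∧
      s = ∑ i ∈ Finset.range n, P.jumpCost η (c i) (c (i + 1))} := by
  refine ⟨0, ?_⟩
  rintro s ⟨n, c, -, -, -, rfl⟩
  exact Finset.sum_nonneg fun i _ => P.jumpCost_nonneg η _ _

theorem shortcutDist_nonempty (x y : P.Space) :
    {s : ℝ | ∃ (n : ℕ) (c : ℕ → P.Space), 1 ≤ n ∧ c 0 = x ∧ c n = y ∧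
      s = ∑ i ∈ Finset.range n, P.jumpCost η (c i) (c (i + 1))}.Nonempty :=
  ⟨_, 1, fun i => if i = 0 then x else y, le_rfl, by simp, by simp, rfl⟩

theorem shortcutDist_self (x : P.Space) : P.shortcutDist η x x = 0 := by
  refine le_antisymm ?_ ?_
  · refine csInf_le (P.shortcutDist_bddBelow η x x) ⟨1, fun _ => x, le_rfl, rfl, rfl, ?_⟩
    simp [jumpCost_self]
  · refine le_csInf (P.shortcutDist_nonempty η x x) ?_
    rintro s ⟨n, c, -, -, -, rfl⟩
    exact Finset.sum_nonneg fun i _ => P.jumpCost_nonneg η _ _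

theorem shortcutDist_comm (x y : P.Space) : P.shortcutDist η x y = P.shortcutDist η y x := by
  have key : ∀ x y : P.Space, P.shortcutDist η x y ≤ P.shortcutDist η y x := by
    intro x y
    refine le_csInf (P.shortcutDist_nonempty η y x) ?_
    rintro s ⟨n, c, hn, h0, h1, rfl⟩
    refine csInf_le (P.shortcutDist_bddBelow η x y)
      ⟨n, fun i => c (n - i), hn, by simpa using h1, by simpa using h0, ?_⟩
    rw [← Finset.sum_range_reflect]
    refine Finset.sum_congr rfl fun i hi => ?_
    have hi := Finset.mem_range.1 hi
    rw [P.jumpCost_comm η]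
    congr 2 <;> omega
  exact le_antisymm (key x y) (key y x)

theorem shortcutDist_triangle (x y z : P.Space) :
    P.shortcutDist η x z ≤ P.shortcutDist η x y + P.shortcutDist η y z := by
  refine le_of_forall_pos_lt_add fun ε hε => ?_
  obtain ⟨s, ⟨n, c, hn, hc0, hc1, rfl⟩, hs⟩ := exists_lt_of_csInf_lt
    (P.shortcutDist_nonempty η x y) (lt_add_of_pos_right (P.shortcutDist η x y) (half_pos hε))
  obtain ⟨s, ⟨m, e, hm, he0, he1, rfl⟩, hs'⟩ := exists_lt_of_csInf_lt
    (P.shortcutDist_nonempty η y z) (lt_add_of_pos_right (P.shortcutDist η y z) (half_pos hε))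
  have hle : P.shortcutDist η x z ≤ (∑ i ∈ Finset.range n, P.jumpCost η (c i) (c (i + 1))) +
      ∑ i ∈ Finset.range m, P.jumpCost η (e i) (e (i + 1)) := by
    refine csInf_le (P.shortcutDist_bddBelow η x z)
      ⟨n + m, fun i => if i < n then c i else e (i - n), by omega, ?_, ?_, ?_⟩
    · simp [show 0 < n by omega, hc0]
    · simp [he1]
    · rw [Finset.sum_range_add]
      congr 1
      · refine Finset.sum_congr rfl fun i hi => ?_
        have hi := Finset.mem_range.1 hi
        by_cases h : i + 1 < n
        · simp [hi, h]
        · have h' : i + 1 = n := by omega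
          simp [hi, h', hc1, he0]
      · refine Finset.sum_congr rfl fun i _ => ?_
        simp [add_assoc]
  linarith

/-- The shortcut Laakso space: the set `P.Space` with the distance `d_η`. -/
def ShortcutSpace (_η : ℕ → Set.Ioc (0 : ℝ) 1) : Type := P.Space

instance : PseudoMetricSpace (P.ShortcutSpace η) where
  dist := P.shortcutDist η
  dist_self := P.shortcutDist_self η
  dist_comm := P.shortcutDist_comm η
  dist_triangle := P.shortcutDist_triangle η

/-- The height on the shortcut Laakso space. -/
def shortcutHeight : P.ShortcutSpace η → ℝ := P.height

end LaaksoData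

end

open scoped ENNReal

noncomputable section

/-! ### Components and dimensions -/

section Dimensions

variable {X Y Z : Type*} [PseudoMetricSpace X] [PseudoMetricSpace Y] [PseudoMetricSpace Z]

/-! Everything rests on the height being Lipschitz light. A Lipschitz light map to the line bounds
the Lipschitz and Nagata dimensions by one, and compactness passes the Nagata bound on to the
covering dimension. All three are positive because the space is connected and has two points at
nonzero distance.

For lightness, let the heights range over a set of diameter at most `r`, choose `K` with `mesh (K +
2) ≤ 10 * r < mesh (K + 1)`, and take a window `I` of radius `5 * r` containing every jump of the
chains considered. Wormhole heights of index at most `K` lie on the grid of side `mesh (K + 1)`,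
which is wider than `I`, so `I` contains at most one of them. Jumps other than shortcuts can thus
change at most one digit of index below `K`. The points over `I` that share the remaining digits
form a cell, of diameter `O(mesh K) = O(r)` (`SameCell.shortcutDist_le`).

A shortcut of index `i < K` may change one more digit. As the `N i` are even, its height is a
wormhole height of index `i + 1 ≤ K`, hence the only one in `I`, and no other shortcut of index
below `K` meets the same cell over `I` (`shortcuts_eq_of_sameCell`). So a chain of cheap jumps,
however long, leaves its first cell through a single shortcut at most (`Reachable.jump`). Shortcuts
stay half a grid step away from the wormholes of their own index, so one that was cheap enough to be
used has width controlled by `r`.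

The metric estimates behind this are an explicit curve switching all fine digits at once
(`laaksoEDist_switch_le`) and the invariance of a digit along any jump too cheap to reach a wormhole
of its index or to cross a shortcut (`mem_digitSet_of_jumpCost_lt`). The latter also shows that
`d_η` separates points. -/

theorem mem_rComponent_iff {A : Set X} {r : ℝ} {x y : X} :
    y ∈ rComponent A r x ↔
      x ∈ A ∧ Relation.ReflTransGen (fun p q => p ∈ A ∧ q ∈ A ∧ dist p q ≤ r) x y := by
  constructor
  · rintro ⟨n, c, rfl, rfl, hA, hd⟩
    refine ⟨hA 0 (Nat.zero_le _), ?_⟩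
    have key : ∀ m ≤ n, Relation.ReflTransGen (fun p q => p ∈ A ∧ q ∈ A ∧ dist p q ≤ r)
        (c 0) (c m) := by
      intro m
      induction m with
      | zero => exact fun _ => Relation.ReflTransGen.refl
      | succ m ih =>
        intro hm
        exact (ih (by omega)).tail ⟨hA m (by omega), hA _ hm, hd m (by omega)⟩
    exact key n le_rfl
  · rintro ⟨hx, h⟩
    induction h with
    | refl => exact ⟨0, fun _ => x, rfl, rfl, fun _ _ => hx, fun _ h => absurd h (by omega)⟩
    | @tail y z _ hyz ih =>
      obtain ⟨n, c, h0, hn, hA, hd⟩ := ih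
      refine ⟨n + 1, fun i => if i ≤ n then c i else z, by simpa using h0, by simp, ?_, ?_⟩
      · intro i _
        by_cases hi : i ≤ n
        · simpa [hi] using hA i hi
        · simpa [hi] using hyz.2.1
      · intro i hi
        by_cases hi' : i + 1 ≤ n
        · simpa [hi', show i ≤ n by omega] using hd i (by omega)
        · obtain rfl : i = n := by omega
          simpa [hn] using hyz.2.2

theorem mem_rComponent_symm {A : Set X} {r : ℝ} {x y : X} (h : y ∈ rComponent A r x) :
    x ∈ rComponent A r y := by
  rw [mem_rComponent_iff] at h ⊢
  have hsymm : Std.Symm (fun p q : X => p ∈ A ∧ q ∈ A ∧ dist p q ≤ r) :=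
    ⟨fun p q hpq => ⟨hpq.2.1, hpq.1, by rw [dist_comm]; exact hpq.2.2⟩⟩
  refine ⟨?_, Std.Symm.symm (r := Relation.ReflTransGen _) _ _ h.2⟩
  rcases Relation.ReflTransGen.cases_tail h.2 with h' | ⟨_, _, h'⟩
  · exact h' ▸ h.1
  · exact h'.2.1

theorem mem_rComponent_trans {A : Set X} {r : ℝ} {x y z : X} (hxy : y ∈ rComponent A r x)
    (hyz : z ∈ rComponent A r y) : z ∈ rComponent A r x := by
  rw [mem_rComponent_iff] at hxy hyz ⊢
  exact ⟨hxy.1, hxy.2.trans hyz.2⟩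

theorem mem_rComponent_of_dist_le {A : Set X} {r : ℝ} {x y : X} (hx : x ∈ A) (hy : y ∈ A)
    (h : dist x y ≤ r) : y ∈ rComponent A r x :=
  mem_rComponent_iff.2 ⟨hx, Relation.ReflTransGen.single ⟨hx, hy, h⟩⟩

theorem mem_rComponent_self {A : Set X} {r : ℝ} {x : X} (hx : x ∈ A) : x ∈ rComponent A r x :=
  mem_rComponent_iff.2 ⟨hx, Relation.ReflTransGen.refl⟩

theorem rComponent_subset {A : Set X} {r : ℝ} {x : X} : rComponent A r x ⊆ A := by
  rintro y ⟨n, c, -, rfl, h, -⟩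
  exact h n le_rfl

theorem ediam_Ico_le (a b : ℝ) : Metric.ediam (Set.Ico a b) ≤ ENNReal.ofReal (b - a) :=
  (Real.ediam_Ico a b).le

/-- A space with a Lipschitz light map to the line has Nagata dimension at most one. -/
theorem nagataDim_le_one_of_isLipschitzLight {f : X → ℝ} (hf : IsLipschitzLight f) :
    nagataDim X ≤ 1 := by
  obtain ⟨C, hC, hlip, hlight⟩ := hf
  refine sInf_le ⟨1, by simp, C * (C + 1), by positivity, fun s hs => ?_⟩
  -- Longer than `s`, and than the length `C * s` that bounds the image of a set of diameter `s`.
  set L := (C + 1) * s with hL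
  have hLpos : 0 < L := by positivity
  have hsL : s ≤ L := by nlinarith
  let I : ℤ → Set ℝ := fun j => Set.Ico (j * L) ((j + 1) * L)
  have hI : ∀ t : ℝ, t ∈ I ⌊t / L⌋ := fun t =>
    ⟨(le_div_iff₀ hLpos).1 (Int.floor_le _), (div_lt_iff₀ hLpos).1 (Int.lt_floor_add_one _)⟩
  have hIdiam : ∀ j, Metric.ediam (I j) ≤ ENNReal.ofReal L := fun j =>
    (ediam_Ico_le _ _).trans (by rw [show ((j : ℝ) + 1) * L - j * L = L by ring])
  refine ⟨{B | ∃ (j : ℤ) (x : X), f x ∈ I j ∧ B = rComponent (f ⁻¹' I j) L x}, ?_, ?_, ?_⟩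
  · refine Set.eq_univ_of_forall fun x => ?_
    exact ⟨_, ⟨_, x, hI (f x), rfl⟩, mem_rComponent_self (hI (f x))⟩
  · rintro B ⟨j, x, hx, rfl⟩
    rw [show C * (C + 1) * s = C * L by rw [hL]; ring]
    exact hlight _ L hLpos (hIdiam j) x hx
  · intro A hA
    have hdist : ∀ a ∈ A, ∀ b ∈ A, dist a b ≤ s := fun a ha b hb => by
      have h := (Metric.edist_le_ediam_of_mem ha hb).trans hA
      rw [edist_dist] at h
      exact (ENNReal.ofReal_le_ofReal_iff hs.le).1 h
    have hfdist : ∀ a ∈ A, ∀ b ∈ A, f b - f a < L := fun a ha b hb => by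
      have h1 := hlip a b
      have h2 := mul_le_mul_of_nonneg_left (hdist a ha b hb) hC.le
      have h3 := neg_abs_le (f a - f b)
      rw [Real.dist_eq] at h1
      nlinarith
    obtain ⟨m, hm⟩ : ∃ m : ℤ, ∀ j : ℤ, ∀ a ∈ A, f a ∈ I j → j = m ∨ j = m + 1 := by
      have hle : ∀ i j : ℤ, ∀ a ∈ A, ∀ b ∈ A, f a ∈ I i → f b ∈ I j → j ≤ i + 1 := by
        intro i j a ha b hb hai hbj
        have h1 : (j : ℝ) * L < ((i : ℝ) + 2) * L := by
          have := hfdist a ha b hb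
          linarith [hbj.1, hai.2]
        have h2 : (j : ℝ) < ((i + 2 : ℤ) : ℝ) := by
          push_cast
          exact lt_of_mul_lt_mul_right h1 hLpos.le
        have h3 : j < i + 2 := by exact_mod_cast h2
        omega
      rcases A.eq_empty_or_nonempty with rfl | ⟨a₀, ha₀⟩
      · exact ⟨0, by simp⟩
      by_cases hex : ∃ a ∈ A, f a ∈ I (⌊f a₀ / L⌋ - 1)
      · obtain ⟨a, ha, haI⟩ := hex
        refine ⟨⌊f a₀ / L⌋ - 1, fun j b hb hbj => ?_⟩
        have h1 := hle _ _ a ha b hb haI hbj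
        have h2 := hle _ _ b hb a₀ ha₀ hbj (hI _)
        omega
      · refine ⟨⌊f a₀ / L⌋, fun j b hb hbj => ?_⟩
        have h1 := hle _ _ a₀ ha₀ b hb (hI _) hbj
        have h2 := hle _ _ b hb a₀ ha₀ hbj (hI _)
        have h3 : j ≠ ⌊f a₀ / L⌋ - 1 := fun h => hex ⟨b, hb, h ▸ hbj⟩
        omega
    -- The part of `A` over one interval lies in a single component, since `s ≤ L`. The interval
    -- therefore determines the member that `A` meets, and only two intervals occur.
    let G : ℤ → Set X := fun j => {y | ∃ a ∈ A, f a ∈ I j ∧ y ∈ rComponent (f ⁻¹' I j) L a}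
    have hsub : {B ∈ {B | ∃ (j : ℤ) (x : X), f x ∈ I j ∧ B = rComponent (f ⁻¹' I j) L x} |
        (B ∩ A).Nonempty} ⊆ G '' {m, m + 1} := by
      rintro B ⟨⟨j, x, hx, rfl⟩, a, haB, haA⟩
      have haI : a ∈ f ⁻¹' I j := rComponent_subset haB
      refine ⟨j, hm j a haA haI, Set.Subset.antisymm ?_ ?_⟩
      · rintro y ⟨b, hb, hbI, hy⟩
        exact mem_rComponent_trans haB (mem_rComponent_trans
          (mem_rComponent_of_dist_le haI hbI ((hdist a haA b hb).trans hsL)) hy)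
      · intro y hy
        exact ⟨a, haA, haI, mem_rComponent_trans (mem_rComponent_symm haB) hy⟩
    refine (Set.encard_le_encard hsub).trans ((Set.encard_image_le _ _).trans ?_)
    refine (Set.encard_insert_le _ _).trans ?_
    simp

/-- On compact spaces the covering dimension is at most the Nagata dimension. -/
theorem topologicalDim_le_nagataDim [CompactSpace X] : topologicalDim X ≤ nagataDim X := by
  refine sInf_le_sInf ?_
  rintro _ ⟨n, rfl, c, hc, H⟩
  refine ⟨n, rfl, fun U hU hcov => ?_⟩
  obtain ⟨δ, hδ, hleb⟩ := lebesgue_number_lemma_of_metric_sUnion isCompact_univ hU hcov.ge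
  -- A set of diameter `c * s`, thickened by `s / 2`, lies within `c * s + s / 2 < δ` of any of its
  -- points. Thickenings containing `x` come from members meeting the ball of radius `s / 2`, whose
  -- diameter is at most `s`.
  set s : ℝ := δ / (c + 2) with hs
  have hspos : 0 < s := by positivity
  obtain ⟨V, hVcov, hVdiam, hVmult⟩ := H s hspos
  refine ⟨(fun B => Metric.thickening (s / 2) B) '' {B ∈ V | B.Nonempty}, ?_, ?_, ?_, ?_⟩
  · rintro _ ⟨B, -, rfl⟩
    exact Metric.isOpen_thickening
  · refine Set.eq_univ_of_forall fun x => ?_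
    obtain ⟨B, hB, hx⟩ := hVcov.ge (Set.mem_univ x)
    exact ⟨_, ⟨B, ⟨hB, x, hx⟩, rfl⟩, Metric.self_subset_thickening (by positivity) B hx⟩
  · rintro _ ⟨B, ⟨hB, x, hx⟩, rfl⟩
    obtain ⟨A, hA, hball⟩ := hleb x (Set.mem_univ x)
    refine ⟨A, hA, fun y hy => hball ?_⟩
    obtain ⟨z, hz, hyz⟩ := Metric.mem_thickening_iff.1 hy
    have h := (Metric.edist_le_ediam_of_mem hz hx).trans (hVdiam B hB)
    rw [edist_dist, ENNReal.ofReal_le_ofReal_iff (by positivity)] at h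
    have h1 := dist_triangle y z x
    have h2 : s * (c + 2) = δ := by rw [hs]; field_simp
    rw [Metric.mem_ball]
    nlinarith
  · intro x
    have hball : Metric.ediam (Metric.ball x (s / 2)) ≤ ENNReal.ofReal s := by
      refine Metric.ediam_le fun y hy z hz => ?_
      rw [edist_dist]
      refine ENNReal.ofReal_le_ofReal ?_
      have := dist_triangle_right y z x
      rw [Metric.mem_ball] at hy hz
      linarith
    refine le_trans ?_ (hVmult _ hball)
    refine le_trans (Set.encard_le_encard ?_)
      (Set.encard_image_le (fun B => Metric.thickening (s / 2) B) _)
    rintro _ ⟨⟨B, ⟨hB, -⟩, rfl⟩, hx⟩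
    obtain ⟨z, hz, hxz⟩ := Metric.mem_thickening_iff.1 hx
    exact ⟨B, ⟨hB, z, hz, by rwa [Metric.mem_ball, dist_comm]⟩, rfl⟩

/-! ### Lower bounds for the dimensions of connected spaces -/

/-- An open cover of multiplicity one consists of disjoint clopen sets, so on a connected space any
nonempty member is everything. It cannot refine a cover by two sets of which one misses `x` and the
other misses `y`. -/
theorem one_le_topologicalDim [PreconnectedSpace X] {x y : X} (hxy : dist x y ≠ 0) :
    1 ≤ topologicalDim X := by
  refine le_sInf ?_
  rintro _ ⟨n, rfl, H⟩
  rw [Order.one_le_iff_ne_zero]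
  intro hn
  obtain rfl : n = 0 := by exact_mod_cast hn
  have hpos : 0 < dist x y := lt_of_le_of_ne dist_nonneg (Ne.symm hxy)
  obtain ⟨V, hVo, hVcov, hVref, hVmult⟩ := H {{z | 0 < dist x z}, {z | 0 < dist y z}} (by
      rintro A (rfl | rfl)
      · exact isOpen_lt continuous_const (continuous_const.dist continuous_id)
      · exact isOpen_lt continuous_const (continuous_const.dist continuous_id)) (by
      refine Set.eq_univ_of_forall fun z => ?_
      by_cases hz : 0 < dist x z
      · exact ⟨_, Or.inl rfl, hz⟩
      · refine ⟨_, Or.inr rfl, ?_⟩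
        have h1 := dist_triangle_right x y z
        simp only [Set.mem_ofPred_eq]
        linarith)
  have hone : ∀ z, ∀ B ∈ V, ∀ B' ∈ V, z ∈ B → z ∈ B' → B = B' := fun z B hB B' hB' h h' =>
    Set.encard_le_one_iff.1 ((hVmult z).trans (by simp)) B B' ⟨hB, h⟩ ⟨hB', h'⟩
  obtain ⟨B, hB, hxB⟩ := hVcov.ge (Set.mem_univ x)
  have hclopen : IsClopen B := by
    refine ⟨⟨?_⟩, hVo B hB⟩
    rw [isOpen_iff_forall_mem_open]
    intro z hz
    obtain ⟨B', hB', hzB'⟩ := hVcov.ge (Set.mem_univ z)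
    refine ⟨B', fun w hw hwB => hz ?_, hVo B' hB', hzB'⟩
    rwa [hone w B hB B' hB' hwB hw]
  have huniv := hclopen.eq_univ ⟨x, hxB⟩
  obtain ⟨A, rfl | rfl, hBA⟩ := hVref B hB
  · have h : 0 < dist x x := hBA hxB
    simp at h
  · have h : 0 < dist y y := hBA (huniv ▸ Set.mem_univ y)
    simp at h

/-- Multiplicity one at scale `s` keeps distinct members at least `s` apart, so they are clopen. The
choice of `s` makes `c * s` half of `dist x y`, too small for a member equal to the whole space. -/
theorem one_le_nagataDim [PreconnectedSpace X] {x y : X} (hxy : dist x y ≠ 0) :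
    1 ≤ nagataDim X := by
  refine le_sInf ?_
  rintro _ ⟨n, rfl, c, hc, H⟩
  rw [Order.one_le_iff_ne_zero]
  intro hn
  obtain rfl : n = 0 := by exact_mod_cast hn
  have hpos : 0 < dist x y := lt_of_le_of_ne dist_nonneg (Ne.symm hxy)
  obtain ⟨V, hVcov, hVdiam, hVmult⟩ := H (dist x y / (2 * c)) (by positivity)
  set s := dist x y / (2 * c) with hs
  have hspos : 0 < s := by positivity
  have hone : ∀ B ∈ V, ∀ y ∈ B, ∀ z, dist y z < s → z ∈ B := by
    intro B hB y hy z hyz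
    obtain ⟨B', hB', hz⟩ := hVcov.ge (Set.mem_univ z)
    have hd : Metric.ediam {y, z} ≤ ENNReal.ofReal s := by
      rw [Metric.ediam_pair, edist_dist]
      exact ENNReal.ofReal_le_ofReal hyz.le
    have := Set.encard_le_one_iff.1 ((hVmult _ hd).trans (by simp)) B B'
      ⟨hB, y, hy, by simp⟩ ⟨hB', z, hz, by simp⟩
    rwa [this]
  obtain ⟨B, hB, hxB⟩ := hVcov.ge (Set.mem_univ x)
  have hclopen : IsClopen B := by
    refine ⟨⟨?_⟩, ?_⟩ <;> rw [Metric.isOpen_iff]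
    · refine fun z hz => ⟨s, hspos, fun w hw hwB => hz (hone B hB w hwB z hw)⟩
    · refine fun z hz => ⟨s, hspos, fun w hw => hone B hB z hz w ?_⟩
      rwa [dist_comm]
  have huniv := hclopen.eq_univ ⟨x, hxB⟩
  have h := (Metric.edist_le_ediam_of_mem hxB (huniv ▸ Set.mem_univ y)).trans (hVdiam B hB)
  rw [edist_dist, ENNReal.ofReal_le_ofReal_iff (by positivity)] at h
  have : c * s = dist x y / 2 := by rw [hs]; field_simp
  linarith

theorem rComponent_univ [PreconnectedSpace X] {r : ℝ} (hr : 0 < r) (x : X) :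
    rComponent (Set.univ : Set X) r x = Set.univ := by
  refine IsClopen.eq_univ ⟨⟨?_⟩, ?_⟩ ⟨x, mem_rComponent_self (Set.mem_univ x)⟩ <;>
    rw [Metric.isOpen_iff]
  · refine fun z hz => ⟨r, hr, fun w hw hwB => hz (mem_rComponent_trans hwB ?_)⟩
    exact mem_rComponent_of_dist_le trivial trivial (le_of_lt hw)
  · refine fun z hz => ⟨r, hr, fun w hw => mem_rComponent_trans hz ?_⟩
    refine mem_rComponent_of_dist_le trivial trivial ?_
    rw [dist_comm]
    exact le_of_lt hw

/-- Euclidean `0`-space is a point, so lightness would bound the `r`-components of the whole space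
for every `r > 0`; connectedness makes such a component the whole space. -/
theorem one_le_lipschitzDim [PreconnectedSpace X] {x y : X} (hxy : dist x y ≠ 0) :
    1 ≤ lipschitzDim X := by
  refine le_sInf ?_
  rintro _ ⟨n, rfl, f, C, hC, -, H⟩
  rw [Order.one_le_iff_ne_zero]
  intro hn
  obtain rfl : n = 0 := by exact_mod_cast hn
  have hpos : 0 < dist x y := lt_of_le_of_ne dist_nonneg (Ne.symm hxy)
  have hr : 0 < dist x y / (2 * C) := by positivity
  have h := H Set.univ _ hr (by rw [Metric.ediam_subsingleton Set.subsingleton_of_subsingleton]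
                                exact bot_le) x trivial
  rw [Set.preimage_univ, rComponent_univ hr] at h
  have h := (Metric.edist_le_ediam_of_mem (Set.mem_univ x) (Set.mem_univ y)).trans h
  rw [edist_dist, ENNReal.ofReal_le_ofReal_iff (by positivity)] at h
  have : C * (dist x y / (2 * C)) = dist x y / 2 := by field_simp
  linarith

theorem IsLipschitzLight.isometry_comp {f : X → Y} (hf : IsLipschitzLight f) {g : Y → Z}
    (hg : Isometry g) : IsLipschitzLight (g ∘ f) := by
  obtain ⟨C, hC, hlip, hlight⟩ := hf
  refine ⟨C, hC, fun x y => by simpa [hg.dist_eq] using hlip x y, fun E r hr hE x hx => ?_⟩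
  rw [Set.preimage_comp]
  refine hlight _ r hr (le_trans ?_ hE) x hx
  rw [← hg.ediam_image]
  exact Metric.ediam_mono (Set.image_preimage_subset g E)

theorem lipschitzDim_le_one_of_isLipschitzLight {f : X → ℝ} (hf : IsLipschitzLight f) :
    lipschitzDim X ≤ 1 := by
  refine sInf_le ⟨1, by simp, _,
    hf.isometry_comp (g := fun t => EuclideanSpace.single (0 : Fin 1) t) ?_⟩
  exact Isometry.of_dist_eq fun a b => by simp

end Dimensions

end

noncomputable section

namespace LaaksoData

/-! ### Scales, wormhole heights and shortcut heights -/

section Heights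

variable (P : LaaksoData)

/-- The side length `1 / (N 0 * ⋯ * N (n - 1))` of the grid of index `n`. -/
def mesh (n : ℕ) : ℝ := 1 / ∏ j ∈ Finset.range n, (P.N j : ℝ)

theorem N_pos (i : ℕ) : 0 < P.N i := lt_of_lt_of_le (by norm_num) (P.four_le_N i)

theorem prod_N_pos (n : ℕ) : 0 < ∏ j ∈ Finset.range n, P.N j :=
  Finset.prod_pos fun j _ => P.N_pos j

theorem mesh_pos (n : ℕ) : 0 < P.mesh n :=
  one_div_pos.2 (Finset.prod_pos fun j _ => by exact_mod_cast P.N_pos j)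

theorem mesh_zero : P.mesh 0 = 1 := by simp [mesh]

theorem scale_eq_mesh (i : ℕ) : P.scale i = P.mesh (i + 1) := rfl

theorem prod_mul_mesh (n : ℕ) : ((∏ j ∈ Finset.range n, P.N j : ℕ) : ℝ) * P.mesh n = 1 := by
  have h : (∏ j ∈ Finset.range n, (P.N j : ℝ)) ≠ 0 :=
    (Finset.prod_pos fun j _ => by exact_mod_cast P.N_pos j).ne'
  rw [mesh]
  push_cast
  field_simp

theorem mesh_eq (n : ℕ) : P.mesh n = P.N n * P.mesh (n + 1) := by
  have h : (P.N n : ℝ) ≠ 0 := by exact_mod_cast (P.N_pos n).ne'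
  rw [mesh, mesh, Finset.prod_range_succ]
  field_simp

theorem mesh_succ_le (n : ℕ) : P.mesh (n + 1) ≤ P.mesh n / 4 := by
  have h : (4 : ℝ) ≤ P.N n := by exact_mod_cast P.four_le_N n
  have := P.mesh_pos (n + 1)
  rw [P.mesh_eq n]
  nlinarith

theorem mesh_strictAnti : StrictAnti P.mesh :=
  strictAnti_nat_of_succ_lt fun n => by
    have := P.mesh_succ_le n
    have := P.mesh_pos n
    linarith

theorem mesh_add_le (n k : ℕ) : P.mesh (n + k) ≤ P.mesh n * (1 / 4) ^ k := by
  induction k with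
  | zero => simp
  | succ k ih =>
    have := P.mesh_succ_le (n + k)
    rw [pow_succ, ← add_assoc]
    linarith

theorem mesh_tendsto : Filter.Tendsto P.mesh Filter.atTop (nhds 0) := by
  refine squeeze_zero (fun n => (P.mesh_pos n).le) (fun n => ?_)
    (tendsto_pow_atTop_nhds_zero_of_lt_one (r := (1 / 4 : ℝ)) (by norm_num) (by norm_num))
  simpa [mesh_zero] using P.mesh_add_le 0 n

/-- The ratios of consecutive scales are bounded. -/
theorem exists_mesh_le : ∃ C : ℝ, 0 < C ∧ ∀ n, P.mesh n ≤ C * P.mesh (n + 1) := by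
  obtain ⟨C, hC, h⟩ := P.comparable
  have hm : ∀ n, ∏ i ∈ Finset.range n, 1 / (P.N i : ℝ) = P.mesh n := fun n => by
    rw [mesh, Finset.prod_div_distrib, Finset.prod_const_one]
  simp only [hm] at h
  refine ⟨C * C / P.θ, div_pos (mul_pos hC hC) P.θ_pos, fun n => ?_⟩
  have h1 := (h n).1
  have h2 := (h (n + 1)).2
  have h3 : P.θ ^ n ≤ C * P.mesh (n + 1) / P.θ := by
    rw [le_div_iff₀ P.θ_pos, ← pow_succ]
    exact h2
  calc P.mesh n ≤ C * P.θ ^ n := h1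
    _ ≤ C * (C * P.mesh (n + 1) / P.θ) := mul_le_mul_of_nonneg_left h3 hC.le
    _ = C * C / P.θ * P.mesh (n + 1) := by ring

/-! ### Wormhole and shortcut heights as grid points -/

theorem exists_sum_eq_mul_mesh {n : ℕ} {t : ℕ → ℕ} (ht : ∀ j < n, t j < P.N j) :
    ∃ m : ℕ, m < ∏ j ∈ Finset.range n, P.N j ∧
      ∑ j ∈ Finset.range n, (t j : ℝ) * P.scale j = m * P.mesh n := by
  induction n with
  | zero => exact ⟨0, by simp, by simp⟩
  | succ n ih =>
    obtain ⟨m, hm, h⟩ := ih fun j hj => ht j (by omega)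
    refine ⟨m * P.N n + t n, ?_, ?_⟩
    · rw [Finset.prod_range_succ]
      have := ht n (by omega)
      nlinarith
    · rw [Finset.sum_range_succ, h, scale_eq_mesh, P.mesh_eq n]
      push_cast
      ring

theorem exists_mul_mesh_eq_sum {n m : ℕ} (hm : m < ∏ j ∈ Finset.range n, P.N j) :
    ∃ t : ℕ → ℕ, (∀ j < n, t j < P.N j) ∧
      ∑ j ∈ Finset.range n, (t j : ℝ) * P.scale j = m * P.mesh n := by
  induction n generalizing m with
  | zero => exact ⟨fun _ => 0, by simp, by simp at hm; simp [hm]⟩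
  | succ n ih =>
    rw [Finset.prod_range_succ] at hm
    obtain ⟨t, ht, h⟩ := ih (m := m / P.N n) (Nat.div_lt_of_lt_mul (by rwa [mul_comm] at hm))
    refine ⟨Function.update t n (m % P.N n), fun j hj => ?_, ?_⟩
    · rcases eq_or_ne j n with rfl | hjn
      · simpa using Nat.mod_lt _ (P.N_pos j)
      · simpa [hjn] using ht j (by omega)
    · have hsum : ∑ j ∈ Finset.range n, ((Function.update t n (m % P.N n) j : ℕ) : ℝ) * P.scale j =
          ∑ j ∈ Finset.range n, (t j : ℝ) * P.scale j :=
        Finset.sum_congr rfl fun j hj => by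
          rw [Function.update_of_ne (Finset.mem_range.1 hj).ne]
      rw [Finset.sum_range_succ, hsum, h, Function.update_self, scale_eq_mesh, P.mesh_eq n]
      have : (m : ℝ) = (P.N n : ℝ) * (m / P.N n : ℕ) + (m % P.N n : ℕ) := by
        exact_mod_cast (Nat.div_add_mod m (P.N n)).symm
      linear_combination (-P.mesh (n + 1)) * this

theorem mem_wormholeHeights_iff {i : ℕ} {s : ℝ} :
    s ∈ P.wormholeHeights i ↔ ∃ m t : ℕ, m < ∏ j ∈ Finset.range i, P.N j ∧ 1 ≤ t ∧ t < P.N i ∧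
      s = m * P.mesh i + t * P.mesh (i + 1) := by
  constructor
  · rintro ⟨t, ht, h1, h2, rfl⟩
    obtain ⟨m, hm, h⟩ := P.exists_sum_eq_mul_mesh ht
    exact ⟨m, t i, hm, h1, h2, by rw [Finset.sum_range_succ, h, scale_eq_mesh]⟩
  · rintro ⟨m, u, hm, h1, h2, rfl⟩
    obtain ⟨t, ht, h⟩ := P.exists_mul_mesh_eq_sum hm
    refine ⟨Function.update t i u, fun j hj => ?_, by simpa using h1, by simpa using h2, ?_⟩
    · simpa [hj.ne] using ht j hj
    · rw [Finset.sum_range_succ, Function.update_self, scale_eq_mesh, ← h]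
      congr 1
      exact Finset.sum_congr rfl fun j hj => by
        rw [Function.update_of_ne (Finset.mem_range.1 hj).ne]

theorem mul_mesh_eq {n k : ℕ} (h : n ≤ k) (m : ℕ) : ∃ m' : ℕ, m * P.mesh n = m' * P.mesh k := by
  induction k, h using Nat.le_induction with
  | base => exact ⟨m, rfl⟩
  | succ k _ ih =>
    obtain ⟨m', h'⟩ := ih
    refine ⟨m' * P.N k, ?_⟩
    rw [h', P.mesh_eq k]
    push_cast
    ring

theorem wormholeHeights_eq_mul_mesh {i n : ℕ} (hi : i < n) {s : ℝ}
    (hs : s ∈ P.wormholeHeights i) : ∃ m : ℕ, s = m * P.mesh n := by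
  obtain ⟨m, t, -, -, -, rfl⟩ := P.mem_wormholeHeights_iff.1 hs
  obtain ⟨m', h⟩ := P.mul_mesh_eq (n := i + 1) (k := n) hi (m * P.N i + t)
  refine ⟨m', ?_⟩
  rw [← h, P.mesh_eq i]
  push_cast
  ring

theorem wormholeHeights_ne_mul_mesh {i : ℕ} {s : ℝ} (hs : s ∈ P.wormholeHeights i) (m : ℕ) :
    s ≠ m * P.mesh i := by
  obtain ⟨m', t, -, h1, h2, rfl⟩ := P.mem_wormholeHeights_iff.1 hs
  intro h
  rw [P.mesh_eq i] at h
  have h' : ((m' * P.N i + t : ℕ) : ℝ) = ((m * P.N i : ℕ) : ℝ) := by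
    push_cast
    exact mul_right_cancel₀ (P.mesh_pos (i + 1)).ne' (by linarith)
  have h3 : m' * P.N i + t = m * P.N i := by exact_mod_cast h'
  have h4 : (m' * P.N i + t) % P.N i = (m * P.N i) % P.N i := by rw [h3]
  rw [mul_comm m', Nat.mul_add_mod, Nat.mod_eq_of_lt h2, Nat.mul_mod_left] at h4
  omega

theorem wormholeHeights_disjoint {i j : ℕ} {s : ℝ} (hi : s ∈ P.wormholeHeights i)
    (hj : s ∈ P.wormholeHeights j) : i = j := by
  by_contra hne
  wlog hij : i < j generalizing i j
  · exact this hj hi (Ne.symm hne) (by omega)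
  obtain ⟨m, hm⟩ := P.wormholeHeights_eq_mul_mesh hij hi
  exact P.wormholeHeights_ne_mul_mesh hj m hm

theorem wormholeHeights_subset_unitInterval {i : ℕ} : P.wormholeHeights i ⊆ unitInterval := by
  intro s hs
  obtain ⟨m, t, hm, -, h2, rfl⟩ := P.mem_wormholeHeights_iff.1 hs
  have h1 := P.mesh_pos i
  have h1' := P.mesh_pos (i + 1)
  have h3 : ((m + 1 : ℕ) : ℝ) * P.mesh i ≤ 1 := by
    rw [← P.prod_mul_mesh i]
    exact mul_le_mul_of_nonneg_right (by exact_mod_cast hm) h1.le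
  have h4 : (t : ℝ) * P.mesh (i + 1) ≤ P.mesh i := by
    rw [P.mesh_eq i]
    exact mul_le_mul_of_nonneg_right (by exact_mod_cast h2.le) h1'.le
  push_cast at h3
  exact ⟨by positivity, by linarith⟩

theorem wormholeHeights_finite (i : ℕ) : (P.wormholeHeights i).Finite := by
  refine ((Finset.range (∏ j ∈ Finset.range i, P.N j) ×ˢ Finset.range (P.N i)).finite_toSet.image
    fun p : ℕ × ℕ => (p.1 : ℝ) * P.mesh i + p.2 * P.mesh (i + 1)).subset ?_
  intro s hs
  obtain ⟨m, t, hm, -, h2, rfl⟩ := P.mem_wormholeHeights_iff.1 hs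
  exact ⟨(m, t), by simp [hm, h2], rfl⟩

/-- Above a grid point there is a wormhole of every finer index, and these accumulate at the grid
point. This lets one short climb change infinitely many digits. -/
theorem mul_mesh_add_mem_wormholeHeights {n i m : ℕ} (hm : m < ∏ j ∈ Finset.range n, P.N j)
    (hi : n ≤ i) : m * P.mesh n + P.mesh (i + 1) ∈ P.wormholeHeights i := by
  have key : ∃ m' : ℕ, m' < ∏ j ∈ Finset.range i, P.N j ∧ m * P.mesh n = m' * P.mesh i := by
    induction i, hi using Nat.le_induction with
    | base => exact ⟨m, hm, rfl⟩
    | succ k _ ih =>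
      obtain ⟨m', h, h'⟩ := ih
      refine ⟨m' * P.N k, ?_, ?_⟩
      · rw [Finset.prod_range_succ]
        exact Nat.mul_lt_mul_of_pos_right h (P.N_pos k)
      · rw [h', P.mesh_eq k]
        push_cast
        ring
  obtain ⟨m', h, h'⟩ := key
  exact P.mem_wormholeHeights_iff.2
    ⟨m', 1, h, le_rfl, lt_of_lt_of_le (by norm_num) (P.four_le_N i), by rw [h']; simp⟩

theorem shortcutHeights_eq {i : ℕ} {s : ℝ} (hs : s ∈ P.shortcutHeights i) :
    ∃ m : ℕ, m < ∏ j ∈ Finset.range (i + 1), P.N j ∧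
      s = m * P.mesh (i + 1) + P.mesh (i + 1) / 2 := by
  obtain ⟨t, ht, -, h2, rfl⟩ := hs
  obtain ⟨m, hm, h⟩ := P.exists_sum_eq_mul_mesh (n := i + 1) (t := t) fun j hj => by
    rcases Nat.lt_succ_iff_lt_or_eq.1 hj with h | rfl
    · exact ht j h
    · omega
  exact ⟨m, hm, by rw [h, scale_eq_mesh]⟩

/-- A midpoint of a cell of side `mesh (i + 1)` is a point of the next grid because `N (i + 1)` is
even; its last coefficient is `N (i + 1) / 2`. -/
theorem shortcutHeights_subset {i : ℕ} : P.shortcutHeights i ⊆ P.wormholeHeights (i + 1) := by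
  intro s hs
  obtain ⟨m, hm, rfl⟩ := P.shortcutHeights_eq hs
  obtain ⟨k, hk⟩ := P.N_even (i + 1)
  have h4 := P.four_le_N (i + 1)
  refine P.mem_wormholeHeights_iff.2 ⟨m, k, hm, by omega, by omega, ?_⟩
  rw [P.mesh_eq (i + 1), hk]
  push_cast
  ring

theorem shortcutHeights_disjoint {i j : ℕ} {s : ℝ} (hi : s ∈ P.shortcutHeights i)
    (hj : s ∈ P.shortcutHeights j) : i = j := by
  have := P.wormholeHeights_disjoint (P.shortcutHeights_subset hi) (P.shortcutHeights_subset hj)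
  omega

/-- Wormholes of index `i` lie on the grid of side `mesh (i + 1)`, and shortcuts of index `i` at
midpoints of its cells. This is what bounds from below the cost of changing a digit by a shortcut.
-/
theorem half_mesh_le_abs_sub {i : ℕ} {s w : ℝ} (hs : s ∈ P.shortcutHeights i)
    (hw : w ∈ P.wormholeHeights i) : P.mesh (i + 1) / 2 ≤ |w - s| := by
  obtain ⟨m, -, rfl⟩ := P.shortcutHeights_eq hs
  obtain ⟨m', rfl⟩ := P.wormholeHeights_eq_mul_mesh (Nat.lt_succ_self i) hw
  have hpos := P.mesh_pos (i + 1)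
  rcases le_or_gt m' m with h | h
  · have h' : (m' : ℝ) ≤ m := by exact_mod_cast h
    rw [le_abs]
    right
    nlinarith
  · have h' : (m : ℝ) + 1 ≤ m' := by exact_mod_cast h
    rw [le_abs]
    left
    nlinarith

theorem mul_mesh_injective {n m m' : ℕ} (h : |m * P.mesh n - m' * P.mesh n| < P.mesh n) :
    m = m' := by
  rw [← sub_mul, abs_mul, abs_of_pos (P.mesh_pos n)] at h
  have h1 : |(m : ℝ) - m'| < 1 := by
    have := P.mesh_pos n
    by_contra h'
    nlinarith
  have h2 : |(m : ℤ) - m'| < 1 := by exact_mod_cast h1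
  rw [Int.abs_lt_one_iff] at h2
  omega

end Heights

end LaaksoData

end

noncomputable section

namespace LaaksoData

/-! ### Curves and upper bounds for the Laakso distance -/

section Curves

variable (P : LaaksoData)

open Classical in
theorem dist_digits_eq (x y : P.Digits) : dist x y =
    if x = y then 0 else P.θ ^ (PiNat.firstDiff (E := fun _ => Fin P.M) x y + 1) := rfl

theorem dist_digits_le {x y : P.Digits} {n : ℕ} (h : ∀ j < n, x j = y j) :
    dist x y ≤ P.θ ^ n := by
  rw [dist_digits_eq]
  split_ifs with hxy
  · exact pow_nonneg P.θ_pos.le n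
  · refine pow_le_pow_of_le_one P.θ_pos.le (P.θ_le.trans (by norm_num)) ?_
    by_contra hlt
    exact PiNat.apply_firstDiff_ne (E := fun _ => Fin P.M) hxy (h _ (by omega))

theorem digits_eq_of_dist_lt {x y : P.Digits} {n : ℕ} (h : dist x y < P.θ ^ n) :
    ∀ j < n, x j = y j := by
  intro j hj
  by_contra hne
  have hxy : x ≠ y := fun h => hne (by rw [h])
  rw [dist_digits_eq, if_neg hxy] at h
  have h1 : ¬ j < PiNat.firstDiff (E := fun _ => Fin P.M) x y := fun hlt =>
    hne (PiNat.apply_eq_of_lt_firstDiff (E := fun _ => Fin P.M) hlt)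
  exact absurd h (not_lt.2 (pow_le_pow_of_le_one P.θ_pos.le (P.θ_le.trans (by norm_num))
    (by omega)))

theorem tendsto_digits {ι : Type*} {l : Filter ι} {f : ι → P.Digits} {a : P.Digits}
    (h : ∀ j, ∀ᶠ u in l, f u j = a j) : Filter.Tendsto f l (nhds a) := by
  rw [Metric.tendsto_nhds]
  intro ε hε
  obtain ⟨n, hn⟩ := exists_pow_lt_of_lt_one hε (lt_of_le_of_lt P.θ_le (by norm_num))
  have : ∀ᶠ u in l, ∀ j ∈ Finset.range n, f u j = a j :=
    (Finset.eventually_all _).2 fun j _ => h j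
  filter_upwards [this] with u hu
  exact (P.dist_digits_le fun j hj => hu j (Finset.mem_range.2 hj)).trans_lt hn

theorem eventually_digits_eq (a : P.Digits) (n : ℕ) :
    ∀ᶠ b in nhds a, ∀ j < n, b j = a j := by
  filter_upwards [Metric.ball_mem_nhds a (pow_pos P.θ_pos n)] with b hb
  exact P.digits_eq_of_dist_lt hb

instance : CompactSpace P.Digits := by
  -- Compactness is carried over from the product topology, where it is Tychonoff's theorem.
  have hc : @Continuous (ℕ → Fin P.M) P.Digits _ _ id := by
    refine continuous_iff_continuousAt.2 fun x => P.tendsto_digits (a := x) fun j => ?_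
    have : ContinuousAt (fun y : ℕ → Fin P.M => y j) x := (continuous_apply j).continuousAt
    exact this.eventually (IsOpen.mem_nhds (isOpen_discrete {x j}) rfl)
  refine ⟨?_⟩
  exact (isCompact_range hc).of_isClosed_subset isClosed_univ fun x _ => ⟨x, rfl⟩

theorem continuous_proj : Continuous P.proj := continuous_quot_mk

theorem continuous_height : Continuous P.height :=
  continuous_quot_lift _ (continuous_subtype_val.comp continuous_fst)

/-- The Laakso distance before conversion to a real number. -/
def laaksoEDist (x y : P.Space) : ℝ≥0∞ :=
  ⨅ (γ : unitInterval → P.Cover) (_ : Continuous (P.proj ∘ γ) ∧ P.proj (γ 0) = x ∧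
    P.proj (γ 1) = y), MeasureTheory.Measure.hausdorffMeasure 1 (Set.range γ)

theorem laaksoEDist_le {x y : P.Space} (γ : unitInterval → P.Cover)
    (h : Continuous (P.proj ∘ γ)) (h0 : P.proj (γ 0) = x) (h1 : P.proj (γ 1) = y) :
    P.laaksoEDist x y ≤ MeasureTheory.Measure.hausdorffMeasure 1 (Set.range γ) :=
  iInf₂_le γ ⟨h, h0, h1⟩

theorem exists_curve {x y : P.Space} {L : ℝ≥0∞} (h : P.laaksoEDist x y < L) :
    ∃ γ : unitInterval → P.Cover, Continuous (P.proj ∘ γ) ∧ P.proj (γ 0) = x ∧ P.proj (γ 1) = y ∧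
      MeasureTheory.Measure.hausdorffMeasure 1 (Set.range γ) < L := by
  obtain ⟨γ, hγ⟩ := iInf_lt_iff.1 h
  obtain ⟨h', hL⟩ := iInf_lt_iff.1 hγ
  exact ⟨γ, h'.1, h'.2.1, h'.2.2, hL⟩

theorem laaksoEDist_triangle (x y z : P.Space) :
    P.laaksoEDist x z ≤ P.laaksoEDist x y + P.laaksoEDist y z := by
  refine ENNReal.le_of_forall_pos_le_add fun ε hε hfin => ?_
  have hε' : (ε : ℝ≥0∞) / 2 ≠ 0 := by simp [hε.ne']
  obtain ⟨hf1, hf2⟩ := ENNReal.add_lt_top.1 hfin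
  obtain ⟨γ, hγ, hγ0, hγ1, hγL⟩ := P.exists_curve (ENNReal.lt_add_right hf1.ne hε')
  obtain ⟨γ', hγ', hγ'0, hγ'1, hγ'L⟩ := P.exists_curve (ENNReal.lt_add_right hf2.ne hε')
  let p : Path x y := ⟨⟨P.proj ∘ γ, hγ⟩, hγ0, hγ1⟩
  let p' : Path y z := ⟨⟨P.proj ∘ γ', hγ'⟩, hγ'0, hγ'1⟩
  -- The two lifts need not meet at the midpoint. Only their projections must, and these concatenate
  -- to a path.
  let β : unitInterval → P.Cover := fun t =>
    if h : (t : ℝ) ≤ 1 / 2 then γ ⟨2 * t, (unitInterval.mul_pos_mem_iff zero_lt_two).2 ⟨t.2.1, h⟩⟩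
    else γ' ⟨2 * t - 1, unitInterval.two_mul_sub_one_mem_iff.2 ⟨(not_le.1 h).le, t.2.2⟩⟩
  have hβ : P.proj ∘ β = p.trans p' := by
    funext t
    rw [Path.trans_apply]
    simp only [β, Function.comp_apply]
    split_ifs <;> rfl
  have hrange : Set.range β ⊆ Set.range γ ∪ Set.range γ' := by
    rintro _ ⟨t, rfl⟩
    simp only [β]
    split_ifs
    · exact Or.inl ⟨_, rfl⟩
    · exact Or.inr ⟨_, rfl⟩
  have h0 : P.proj (β 0) = x := (congrFun hβ 0).trans (p.trans p').source
  have h1 : P.proj (β 1) = z := (congrFun hβ 1).trans (p.trans p').target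
  refine (P.laaksoEDist_le β (by rw [hβ]; exact (p.trans p').continuous) h0 h1).trans ?_
  refine (MeasureTheory.measure_mono hrange).trans ((MeasureTheory.measure_union_le _ _).trans ?_)
  refine (add_le_add hγL.le hγ'L.le).trans (le_of_eq ?_)
  rw [add_add_add_comm, ENNReal.add_halves]

/-- The vertical segment over `[s, t]` with constant digits. -/
theorem hausdorffMeasure_segment_le (s t : ℝ) (a : P.Digits) :
    MeasureTheory.Measure.hausdorffMeasure 1
      {x : P.Cover | (x.1 : ℝ) ∈ Set.Icc s t ∧ x.2 = a} ≤ ENNReal.ofReal (t - s) := by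
  have hiso : Isometry (fun u : unitInterval => ((u, a) : P.Cover)) :=
    Isometry.of_dist_eq fun u v => by simp [Prod.dist_eq]
  have hset : {x : P.Cover | (x.1 : ℝ) ∈ Set.Icc s t ∧ x.2 = a} =
      (fun u : unitInterval => ((u, a) : P.Cover)) '' (Subtype.val ⁻¹' Set.Icc s t) := by
    ext ⟨u, b⟩
    constructor
    · rintro ⟨h, rfl⟩
      exact ⟨u, h, rfl⟩
    · rintro ⟨v, hv, h⟩
      obtain ⟨rfl, rfl⟩ := Prod.mk.inj h
      exact ⟨hv, rfl⟩
  rw [hset, hiso.hausdorffMeasure_image (Or.inl zero_le_one),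
    ← isometry_subtype_coe.hausdorffMeasure_image (Or.inl zero_le_one),
    MeasureTheory.hausdorffMeasure_real]
  exact (MeasureTheory.measure_mono (Set.image_preimage_subset _ _)).trans Real.volume_Icc.le

theorem laaksoEDist_vertical_le (s t : unitInterval) (a : P.Digits) :
    P.laaksoEDist (P.proj (s, a)) (P.proj (t, a)) ≤ ENNReal.ofReal |(s : ℝ) - t| := by
  have hmem : ∀ u : unitInterval, (s : ℝ) + u * (t - s) ∈ Set.uIcc (s : ℝ) t := fun u => by
    rw [Set.mem_uIcc]
    have h0 := u.2.1
    have h1 := u.2.2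
    rcases le_total (s : ℝ) t with h | h
    · left
      constructor <;> nlinarith
    · right
      constructor <;> nlinarith
  have hunit : ∀ u : unitInterval, (s : ℝ) + u * (t - s) ∈ unitInterval := fun u =>
    Set.uIcc_subset_Icc s.2 t.2 (hmem u)
  let γ : unitInterval → P.Cover := fun u => (⟨(s : ℝ) + u * (t - s), hunit u⟩, a)
  have hγ : Continuous γ := by
    refine Continuous.prodMk (Continuous.subtype_mk ?_ _) continuous_const
    fun_prop
  refine (P.laaksoEDist_le γ (P.continuous_proj.comp hγ) ?_ ?_).trans ?_
  · exact congrArg P.proj (Prod.ext (Subtype.ext (by simp [γ])) rfl)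
  · exact congrArg P.proj (Prod.ext (Subtype.ext (by simp [γ])) rfl)
  · refine (MeasureTheory.measure_mono ?_).trans
      ((P.hausdorffMeasure_segment_le (min (s : ℝ) t) (max (s : ℝ) t) a).trans ?_)
    · rintro _ ⟨u, rfl⟩
      exact ⟨hmem u, rfl⟩
    · rw [max_sub_min_eq_abs, abs_sub_comm]

theorem tsum_quarter_pow : ∑' k : ℕ, ENNReal.ofReal ((1 / 4) ^ k) = ENNReal.ofReal (4 / 3) := by
  rw [← ENNReal.ofReal_tsum_of_nonneg (fun k => by positivity)
    (summable_geometric_of_lt_one (by norm_num) (by norm_num)),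
    tsum_geometric_of_lt_one (by norm_num) (by norm_num)]
  norm_num

/-- Starting at a grid height, all digits of index at least `n` can be changed at once by climbing
by one step of the grid of index `n + 1`: the digit of index `j` is changed at the wormhole at
distance `mesh (j + 1)` from the start. -/
theorem laaksoEDist_switch_le {n m : ℕ} (hm : m < ∏ j ∈ Finset.range n, P.N j)
    {a b : P.Digits} (hab : ∀ j < n, a j = b j) {v w : unitInterval}
    (hv : (v : ℝ) = m * P.mesh n) (hw : (w : ℝ) = v + P.mesh (n + 1)) :
    P.laaksoEDist (P.proj (v, a)) (P.proj (w, b)) ≤ ENNReal.ofReal (P.mesh n) := by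
  set L := P.mesh (n + 1) with hL
  have hLpos : 0 < L := P.mesh_pos _
  have hunit : ∀ u : unitInterval, (v : ℝ) + u * L ∈ unitInterval := fun u => by
    have h0 := u.2.1
    have h1 := u.2.2
    have h2 := w.2.2
    have h3 := v.2.1
    exact ⟨by positivity, by nlinarith⟩
  let ht : unitInterval → unitInterval := fun u => ⟨(v : ℝ) + u * L, hunit u⟩
  have hht : Continuous ht := Continuous.subtype_mk (by fun_prop) _
  -- Digit `j` changes at height `v + mesh (j + 1)`. With `<` the digits are right continuous; with
  -- `≤` they give the limit from the left.
  let dg : unitInterval → P.Digits := fun u j => if (u : ℝ) * L < P.mesh (j + 1) then a j else b j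
  let dg' : unitInterval → P.Digits := fun u j => if (u : ℝ) * L ≤ P.mesh (j + 1) then a j else b j
  let γ : unitInterval → P.Cover := fun u => (ht u, dg u)
  have hcont : Continuous (fun u : unitInterval => (u : ℝ) * L) := by fun_prop
  -- The one-sided limits differ at most in the digit being switched, and then the current height is
  -- a wormhole of that index.
  have hleft : ∀ u, P.proj (ht u, dg' u) = P.proj (γ u) := fun u => by
    refine Quot.sound ?_
    by_cases hex : ∃ i, (u : ℝ) * L = P.mesh (i + 1)
    · obtain ⟨i, hi⟩ := hex
      by_cases hin : i < n
      · left
        refine Prod.ext rfl (funext fun j => ?_)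
        simp only [dg, dg', γ]
        rcases lt_trichotomy ((u : ℝ) * L) (P.mesh (j + 1)) with h | h | h
        · simp [h, h.le]
        · have : j = i := by
            have := P.mesh_strictAnti.injective (h.symm.trans hi)
            omega
          subst this
          simp [h, hab j hin]
        · simp [h.not_gt, h.not_ge]
      · right
        refine ⟨i, rfl, ?_, fun j hj => ?_⟩
        · change (v : ℝ) + u * L ∈ _
          rw [hv, hi]
          exact P.mul_mesh_add_mem_wormholeHeights hm (by omega)
        · have hne : (u : ℝ) * L ≠ P.mesh (j + 1) := fun h => hj (by
            have := P.mesh_strictAnti.injective (h.symm.trans hi)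
            omega)
          simp only [dg, dg', γ, hne.le_iff_lt]
    · left
      refine Prod.ext rfl (funext fun j => ?_)
      have hne : (u : ℝ) * L ≠ P.mesh (j + 1) := fun h => hex ⟨j, h⟩
      simp only [dg, dg', γ, hne.le_iff_lt]
  have hγ : Continuous (P.proj ∘ γ) := by
    refine continuous_iff_continuousAt.2 fun u₀ => ?_
    rw [ContinuousAt, ← nhdsLT_sup_nhdsGE, Filter.tendsto_sup]
    constructor
    · change Filter.Tendsto _ _ (nhds (P.proj (γ u₀)))
      rw [← hleft u₀]
      refine (P.continuous_proj.tendsto _).comp ?_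
      refine (hht.continuousAt.mono_left inf_le_left).prodMk_nhds (P.tendsto_digits fun j => ?_)
      by_cases hj : (u₀ : ℝ) * L ≤ P.mesh (j + 1)
      · filter_upwards [self_mem_nhdsWithin] with u hu
        have hu' : (u : ℝ) < u₀ := hu
        have : (u : ℝ) * L < P.mesh (j + 1) := by nlinarith
        simp [dg, dg', hj, this]
      · have hev : ∀ᶠ u : unitInterval in nhdsWithin u₀ (Set.Iio u₀), P.mesh (j + 1) < (u : ℝ) * L :=
          (hcont.continuousAt.mono_left inf_le_left).eventually
            (lt_mem_nhds (not_le.1 hj))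
        filter_upwards [hev] with u hu
        simp [dg, dg', hj, hu.not_gt]
    · refine (P.continuous_proj.tendsto _).comp ?_
      refine (hht.continuousAt.mono_left inf_le_left).prodMk_nhds (P.tendsto_digits fun j => ?_)
      by_cases hj : (u₀ : ℝ) * L < P.mesh (j + 1)
      · have hev : ∀ᶠ u : unitInterval in nhdsWithin u₀ (Set.Ici u₀), (u : ℝ) * L < P.mesh (j + 1) :=
          (hcont.continuousAt.mono_left inf_le_left).eventually (gt_mem_nhds hj)
        filter_upwards [hev] with u hu
        simp [dg, hj, hu]
      · filter_upwards [self_mem_nhdsWithin] with u hu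
        have hu' : (u₀ : ℝ) ≤ u := hu
        have : ¬ (u : ℝ) * L < P.mesh (j + 1) := by
          have := mul_le_mul_of_nonneg_right hu' hLpos.le
          rw [not_lt] at hj ⊢
          linarith
        simp [dg, hj, this]
  have h0 : γ 0 = (v, a) := by
    refine Prod.ext (Subtype.ext ?_) (funext fun j => ?_)
    · simp [γ, ht]
    · simp [γ, dg, P.mesh_pos]
  have h1 : γ 1 = (w, b) := by
    refine Prod.ext (Subtype.ext ?_) (funext fun j => ?_)
    · simp [γ, ht, hw]
    · by_cases hj : j < n
      · simp [γ, dg, hab j hj]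
      · have : ¬ L < P.mesh (j + 1) := not_lt.2 (P.mesh_strictAnti.antitone (by omega))
        simp [γ, dg, this]
  refine (P.laaksoEDist_le γ hγ (by rw [h0]) (by rw [h1])).trans ?_
  -- Apart from its endpoints, the lift lies on countably many vertical segments, one for each
  -- number of digits still to be switched. Their lengths decay geometrically, with sum at most `4 *
  -- L / 3 ≤ mesh n`.
  let c : ℕ → P.Digits := fun k j => if j ≤ k then a j else b j
  have hrange : Set.range γ ⊆ {((v, a) : P.Cover), (w, b)} ∪
      ⋃ k : ℕ, {x : P.Cover | (x.1 : ℝ) ∈ Set.Icc (v : ℝ) (v + P.mesh (n + 1 + k)) ∧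
        x.2 = c (n + k)} := by
    rintro _ ⟨u, rfl⟩
    rcases u.2.1.eq_or_lt with hu | hu
    · left
      left
      rw [← h0]
      congr 1
      exact Subtype.ext hu.symm
    rcases u.2.2.eq_or_lt with hu1 | hu1
    · left
      right
      rw [Set.mem_singleton_iff, ← h1]
      congr 1
      exact Subtype.ext hu1
    right
    have hpos : 0 < (u : ℝ) * L := by positivity
    have hex : ∃ k, P.mesh k ≤ (u : ℝ) * L :=
      (P.mesh_tendsto.eventually (gt_mem_nhds hpos)).exists.imp fun k hk => hk.le
    classical
    have hfind := Nat.find_spec hex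
    have hmin : ∀ k, k < Nat.find hex → (u : ℝ) * L < P.mesh k := fun k hk =>
      not_le.1 (Nat.find_min hex hk)
    have hgt : n + 1 < Nat.find hex := by
      by_contra hle
      have h2 := P.mesh_strictAnti.antitone (not_lt.1 hle)
      have h3 : (u : ℝ) * L < L := by nlinarith
      linarith
    -- If `k` is the least index with `mesh k ≤ u * L`, exactly the digits of index at most `k - 2`
    -- are unswitched, and the climb so far is less than `mesh (k - 1)`.
    refine Set.mem_iUnion.2 ⟨Nat.find hex - (n + 2), ⟨?_, ?_⟩, funext fun j => ?_⟩
    · change (v : ℝ) ≤ v + u * L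
      linarith
    · change (v : ℝ) + u * L ≤ _
      have := hmin (n + 1 + (Nat.find hex - (n + 2))) (by omega)
      linarith
    · simp only [γ, dg, c]
      congr 1
      refine propext ⟨fun h => ?_, fun h => hmin _ (by omega)⟩
      by_contra hlt
      have := P.mesh_strictAnti.antitone (show Nat.find hex ≤ j + 1 by omega)
      linarith
  have hnull := MeasureTheory.Measure.nullSingletonClass_hausdorff P.Cover (zero_lt_one (α := ℝ))
  refine (MeasureTheory.measure_mono hrange).trans ((MeasureTheory.measure_union_le _ _).trans ?_)
  rw [(Set.toFinite {((v, a) : P.Cover), (w, b)}).measure_zero, zero_add]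
  refine (MeasureTheory.measure_iUnion_le _).trans ?_
  calc _ ≤ ∑' k : ℕ, ENNReal.ofReal L * ENNReal.ofReal ((1 / 4) ^ k) := by
        refine ENNReal.tsum_le_tsum fun k => (P.hausdorffMeasure_segment_le _ _ _).trans ?_
        rw [← ENNReal.ofReal_mul hLpos.le]
        refine ENNReal.ofReal_le_ofReal ?_
        rw [add_sub_cancel_left]
        exact P.mesh_add_le (n + 1) k
    _ = ENNReal.ofReal (L * (4 / 3)) := by
        rw [ENNReal.tsum_mul_left, tsum_quarter_pow, ENNReal.ofReal_mul hLpos.le]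
    _ ≤ ENNReal.ofReal (P.mesh n) := by
        refine ENNReal.ofReal_le_ofReal ?_
        have := P.mesh_succ_le n
        linarith

theorem laaksoEDist_le_of_digits_eq {n : ℕ} {s t : unitInterval} {a b : P.Digits}
    (hab : ∀ j < n, a j = b j) : P.laaksoEDist (P.proj (s, a)) (P.proj (t, b)) ≤
      ENNReal.ofReal (|(s : ℝ) - t| + 3 * P.mesh n) := by
  have hpos := P.mesh_pos n
  -- The grid cell containing `s`; the top height `s = 1` is assigned to the last cell.
  obtain ⟨m, hm, h1, h2⟩ : ∃ m : ℕ, m < ∏ j ∈ Finset.range n, P.N j ∧ m * P.mesh n ≤ s ∧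
      (s : ℝ) ≤ m * P.mesh n + P.mesh n := by
    have hprod := P.prod_mul_mesh n
    have hppos := P.prod_N_pos n
    generalize ∏ j ∈ Finset.range n, P.N j = p at *
    rcases s.2.2.eq_or_lt with hs | hs
    · refine ⟨p - 1, by omega, ?_, ?_⟩ <;> rw [hs, Nat.cast_sub (by omega)] <;> push_cast <;>
        linarith
    · have hfl := Nat.floor_le (div_nonneg s.2.1 hpos.le)
      have hlt := Nat.lt_floor_add_one ((s : ℝ) / P.mesh n)
      rw [le_div_iff₀ hpos] at hfl
      rw [div_lt_iff₀ hpos] at hlt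
      refine ⟨⌊(s : ℝ) / P.mesh n⌋₊, ?_, hfl, by linarith⟩
      have : ((⌊(s : ℝ) / P.mesh n⌋₊ : ℕ) : ℝ) < p := by
        rw [← mul_lt_mul_iff_left₀ hpos]
        linarith
      exact_mod_cast this
  have hw := P.wormholeHeights_subset_unitInterval (P.mul_mesh_add_mem_wormholeHeights hm le_rfl)
  have hv : (m : ℝ) * P.mesh n ∈ unitInterval :=
    ⟨mul_nonneg (Nat.cast_nonneg _) hpos.le, h1.trans s.2.2⟩
  have hsucc := P.mesh_succ_le n
  have hsucc0 := P.mesh_pos (n + 1)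
  -- Route: down to the base of the cell, up while switching the digits, then vertically to `t`.
  refine (P.laaksoEDist_triangle _ (P.proj (⟨_, hv⟩, a)) _).trans ?_
  refine (add_le_add (P.laaksoEDist_vertical_le _ _ _)
    (P.laaksoEDist_triangle _ (P.proj (⟨_, hw⟩, b)) _)).trans ?_
  refine (add_le_add le_rfl (add_le_add
    (P.laaksoEDist_switch_le hm hab rfl rfl) (P.laaksoEDist_vertical_le _ _ _))).trans ?_
  rw [← ENNReal.ofReal_add hpos.le (abs_nonneg _), ← ENNReal.ofReal_add (abs_nonneg _)
    (add_nonneg hpos.le (abs_nonneg _))]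
  refine ENNReal.ofReal_le_ofReal ?_
  have h3 : |(s : ℝ) - m * P.mesh n| ≤ P.mesh n := by
    rw [abs_of_nonneg (by linarith)]
    linarith
  have h4 : |(m : ℝ) * P.mesh n + P.mesh (n + 1) - t| ≤ P.mesh n + |(s : ℝ) - t| := by
    have h5 : |(m : ℝ) * P.mesh n + P.mesh (n + 1) - s| ≤ P.mesh n := by
      rw [abs_le]
      constructor <;> linarith
    linarith [abs_sub_le ((m : ℝ) * P.mesh n + P.mesh (n + 1)) s t]
  dsimp only
  linarith

theorem laaksoEDist_ne_top (x y : P.Space) : P.laaksoEDist x y ≠ ⊤ := by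
  obtain ⟨⟨s, a⟩, rfl⟩ := Quot.exists_rep x
  obtain ⟨⟨t, b⟩, rfl⟩ := Quot.exists_rep y
  exact ne_top_of_le_ne_top ENNReal.ofReal_ne_top
    (P.laaksoEDist_le_of_digits_eq (n := 0) (by simp))

theorem laaksoDist_le_of_digits_eq {n : ℕ} {s t : unitInterval} {a b : P.Digits}
    (hab : ∀ j < n, a j = b j) : P.laaksoDist (P.proj (s, a)) (P.proj (t, b)) ≤
      |(s : ℝ) - t| + 3 * P.mesh n := by
  have := P.mesh_pos n
  exact ENNReal.toReal_le_of_le_ofReal (by positivity) (P.laaksoEDist_le_of_digits_eq hab)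

end Curves

end LaaksoData

end

noncomputable section

namespace LaaksoData

/-! ### Lower bounds for the distances -/

section LowerBounds

variable (P : LaaksoData) (η : ℕ → Set.Ioc (0 : ℝ) 1)

/-- The points whose height is not a wormhole height of index `i` and whose digit of index `i`,
which is then well defined, is `α`. -/
def digitSet (i : ℕ) (α : Fin P.M) : Set P.Space :=
  {x | Quot.lift (fun z : P.Cover => (z.1 : ℝ) ∉ P.wormholeHeights i ∧ z.2 i = α) (by
    rintro x y (rfl | ⟨j, h1, h2, h3⟩)
    · rfl
    · refine propext ?_
      rw [← h1]
      refine and_congr_right fun hx => ?_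
      rw [h3 i fun hij => hx (hij ▸ h2)]) x}

variable {P} in
theorem digitSet_unique {i : ℕ} {α β : Fin P.M} {x : P.Space} (hα : x ∈ P.digitSet i α)
    (hβ : x ∈ P.digitSet i β) : α = β := by
  obtain ⟨z, rfl⟩ := Quot.exists_rep x
  exact hα.2.symm.trans hβ.2

variable {P} in
theorem exists_mem_digitSet {i : ℕ} {x : P.Space} (hx : P.height x ∉ P.wormholeHeights i) :
    ∃ α, x ∈ P.digitSet i α := by
  obtain ⟨z, rfl⟩ := Quot.exists_rep x
  exact ⟨z.2 i, hx, rfl⟩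

theorem isOpen_digitSet (i : ℕ) (α : Fin P.M) : IsOpen (P.digitSet i α) := by
  have h : IsOpen (P.proj ⁻¹' P.digitSet i α) := by
    have h1 : IsOpen {z : P.Cover | (z.1 : ℝ) ∉ P.wormholeHeights i} :=
      (P.wormholeHeights_finite i).isClosed.isOpen_compl.preimage
        (continuous_subtype_val.comp continuous_fst)
    have h2 : IsOpen {a : P.Digits | a i = α} := isOpen_iff_mem_nhds.2 fun a ha => by
      filter_upwards [P.eventually_digits_eq a (i + 1)] with b hb
      exact (hb i (Nat.lt_succ_self i)).trans ha
    exact h1.inter (h2.preimage continuous_snd)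
  exact isOpen_coinduced.2 h

/-- The lift may jump, but its height factors through the continuous projection and so takes all
intermediate values. The height on the cover is 1-Lipschitz and does not increase `ℋ¹`. -/
theorem abs_height_sub_le_hausdorffMeasure {γ : unitInterval → P.Cover}
    (hγ : Continuous (P.proj ∘ γ)) (u v : unitInterval) :
    ENNReal.ofReal |((γ u).1 : ℝ) - (γ v).1| ≤
      MeasureTheory.Measure.hausdorffMeasure 1 (Set.range γ) := by
  have hf : Continuous (fun u => ((γ u).1 : ℝ)) := P.continuous_height.comp hγ
  have hsub : Set.uIcc ((γ v).1 : ℝ) (γ u).1 ⊆ Set.range fun u => ((γ u).1 : ℝ) :=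
    (isPreconnected_range hf).ordConnected.uIcc_subset ⟨v, rfl⟩ ⟨u, rfl⟩
  have hlip : LipschitzWith 1 (fun x : P.Cover => (x.1 : ℝ)) :=
    (LipschitzWith.subtype_val _).comp LipschitzWith.prod_fst |>.weaken (by simp)
  have himage := hlip.hausdorffMeasure_image_le (zero_le_one (α := ℝ)) (Set.range γ)
  rw [← Set.range_comp, MeasureTheory.hausdorffMeasure_real] at himage
  simp only [ENNReal.coe_one, ENNReal.one_rpow, one_mul] at himage
  rw [← Real.volume_interval]
  exact (MeasureTheory.measure_mono hsub).trans himage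

theorem exists_curve_of_laaksoDist_lt {x y : P.Space} {L : ℝ} (h : P.laaksoDist x y < L) :
    ∃ γ : unitInterval → P.Cover, Continuous (P.proj ∘ γ) ∧ P.proj (γ 0) = x ∧ P.proj (γ 1) = y ∧
      ∀ u v, |((γ u).1 : ℝ) - (γ v).1| < L := by
  have h' : P.laaksoEDist x y < ENNReal.ofReal L :=
    (ENNReal.lt_ofReal_iff_toReal_lt (P.laaksoEDist_ne_top x y)).2 h
  obtain ⟨γ, hγ, h0, h1, hL⟩ := P.exists_curve h'
  refine ⟨γ, hγ, h0, h1, fun u v => ?_⟩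
  exact (ENNReal.ofReal_lt_ofReal_iff_of_nonneg (abs_nonneg _)).1
    ((P.abs_height_sub_le_hausdorffMeasure hγ u v).trans_lt hL)

theorem abs_height_sub_le_laaksoDist (x y : P.Space) :
    |P.height x - P.height y| ≤ P.laaksoDist x y := by
  refine le_of_forall_gt_imp_ge_of_dense fun L hL => ?_
  obtain ⟨γ, -, rfl, rfl, h⟩ := P.exists_curve_of_laaksoDist_lt hL
  exact (h 0 1).le

/-- A curve that is too short to reach a wormhole of index `i` preserves the digit of index `i`. -/
theorem mem_digitSet_of_laaksoDist_lt {i : ℕ} {α : Fin P.M} {x y : P.Space} {L : ℝ}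
    (hx : x ∈ P.digitSet i α) (hL : ∀ w ∈ P.wormholeHeights i, L ≤ |w - P.height x|)
    (h : P.laaksoDist x y < L) : y ∈ P.digitSet i α := by
  obtain ⟨γ, hγ, rfl, rfl, hd⟩ := P.exists_curve_of_laaksoDist_lt h
  have hW : ∀ u, ((γ u).1 : ℝ) ∉ P.wormholeHeights i := fun u hu =>
    absurd (hL _ hu) (not_le.2 (hd u 0))
  have hloc : IsLocallyConstant fun u => (γ u).2 i := by
    rw [IsLocallyConstant.iff_exists_open]
    intro u
    refine ⟨(P.proj ∘ γ) ⁻¹' P.digitSet i ((γ u).2 i), (P.isOpen_digitSet i _).preimage hγ,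
      ⟨hW u, rfl⟩, fun v hv => hv.2⟩
  exact ⟨hW 1, (hloc.apply_eq_of_preconnectedSpace 1 0).trans hx.2⟩

theorem height_of_mem_shortcuts {i : ℕ} {S : Set P.Space} (hS : S ∈ P.shortcuts i) {x y : P.Space}
    (hx : x ∈ S) (hy : y ∈ S) : P.height x = P.height y ∧ P.height x ∈ P.shortcutHeights i := by
  obtain ⟨t, ht, a, rfl⟩ := hS
  obtain ⟨x, hx, rfl⟩ := hx
  obtain ⟨y, hy, rfl⟩ := hy
  have h1 : P.height (P.proj x) = t := hx.1
  have h2 : P.height (P.proj y) = t := hy.1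
  exact ⟨h1.trans h2.symm, h1 ▸ ht⟩

theorem mem_digitSet_of_mem_shortcuts {i j : ℕ} (hij : j ≠ i) {S : Set P.Space}
    (hS : S ∈ P.shortcuts i) {x y : P.Space} (hxS : x ∈ S) (hyS : y ∈ S) {α : Fin P.M}
    (hx : x ∈ P.digitSet j α) : y ∈ P.digitSet j α := by
  obtain ⟨t, ht, a, rfl⟩ := hS
  obtain ⟨x, hxS, rfl⟩ := hxS
  obtain ⟨y, hyS, rfl⟩ := hyS
  have h1 : (x.1 : ℝ) = y.1 := hxS.1.trans hyS.1.symm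
  refine ⟨h1 ▸ hx.1, ?_⟩
  rw [← hx.2]
  rcases lt_or_gt_of_ne hij with h | h
  · rw [hxS.2.1 j h, hyS.2.1 j h]
  · rw [hxS.2.2 j h, hyS.2.2 j h]

theorem jumpCost_of_mem_shortcuts {i : ℕ} {S : Set P.Space} (hS : S ∈ P.shortcuts i)
    {x y : P.Space} (hx : x ∈ S) (hy : y ∈ S) :
    P.jumpCost η x y = η i * P.laaksoDist x y := by
  classical
  have hex : ∃ i, ∃ S ∈ P.shortcuts i, x ∈ S ∧ y ∈ S := ⟨i, S, hS, hx, hy⟩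
  rw [jumpCost, dif_pos hex]
  obtain ⟨S', hS', hx', hy'⟩ := Nat.find_spec hex
  have := P.shortcutHeights_disjoint (P.height_of_mem_shortcuts hS' hx' hy').2
    (P.height_of_mem_shortcuts hS hx hy).2
  convert rfl using 4
  convert this.symm

theorem jumpCost_of_notMem_shortcuts {x y : P.Space}
    (h : ¬ ∃ i, ∃ S ∈ P.shortcuts i, x ∈ S ∧ y ∈ S) :
    P.jumpCost η x y = P.laaksoDist x y := by
  rw [jumpCost, dif_neg h]

theorem jumpCost_le_laaksoDist (x y : P.Space) : P.jumpCost η x y ≤ P.laaksoDist x y := by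
  by_cases h : ∃ i, ∃ S ∈ P.shortcuts i, x ∈ S ∧ y ∈ S
  · obtain ⟨i, S, hS, hx, hy⟩ := h
    rw [P.jumpCost_of_mem_shortcuts η hS hx hy]
    exact mul_le_of_le_one_left ENNReal.toReal_nonneg (η i).2.2
  · exact (P.jumpCost_of_notMem_shortcuts η h).le

theorem abs_height_sub_le_jumpCost (x y : P.Space) :
    |P.height x - P.height y| ≤ P.jumpCost η x y := by
  by_cases h : ∃ i, ∃ S ∈ P.shortcuts i, x ∈ S ∧ y ∈ S
  · obtain ⟨i, S, hS, hx, hy⟩ := h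
    rw [(P.height_of_mem_shortcuts hS hx hy).1, sub_self, abs_zero]
    exact P.jumpCost_nonneg η x y
  · rw [P.jumpCost_of_notMem_shortcuts η h]
    exact P.abs_height_sub_le_laaksoDist x y

/-- A cheap jump preserves the digit of index `i`, unless it uses a shortcut of index `i`. -/
theorem mem_digitSet_of_jumpCost_lt {i : ℕ} {α : Fin P.M} {x y : P.Space} {L : ℝ}
    (hx : x ∈ P.digitSet i α) (hL : ∀ w ∈ P.wormholeHeights i, L ≤ |w - P.height x|)
    (h : P.jumpCost η x y < L) : y ∈ P.digitSet i α ∨ ∃ S ∈ P.shortcuts i, x ∈ S ∧ y ∈ S ∧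
      ∀ L', (∀ w ∈ P.wormholeHeights i, L' ≤ |w - P.height x|) →
        η i * L' ≤ P.jumpCost η x y := by
  by_cases hex : ∃ i, ∃ S ∈ P.shortcuts i, x ∈ S ∧ y ∈ S
  · obtain ⟨j, S, hS, hxS, hyS⟩ := hex
    rcases ne_or_eq i j with hij | rfl
    · exact Or.inl (P.mem_digitSet_of_mem_shortcuts hij hS hxS hyS hx)
    · rw [or_iff_not_imp_left]
      refine fun hy => ⟨S, hS, hxS, hyS, fun L' hL' => ?_⟩
      rw [P.jumpCost_of_mem_shortcuts η hS hxS hyS]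
      refine mul_le_mul_of_nonneg_left ?_ (η i).2.1.le
      by_contra hlt
      exact hy (P.mem_digitSet_of_laaksoDist_lt hx hL' (not_le.1 hlt))
  · rw [P.jumpCost_of_notMem_shortcuts η hex] at h
    exact Or.inl (P.mem_digitSet_of_laaksoDist_lt hx hL h)

theorem shortcutDist_le_jumpCost (x y : P.Space) :
    P.shortcutDist η x y ≤ P.jumpCost η x y :=
  csInf_le (P.shortcutDist_bddBelow η x y)
    ⟨1, fun i => if i = 0 then x else y, le_rfl, by simp, by simp, by simp⟩

theorem shortcutDist_le_laaksoDist (x y : P.Space) :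
    P.shortcutDist η x y ≤ P.laaksoDist x y :=
  (P.shortcutDist_le_jumpCost η x y).trans (P.jumpCost_le_laaksoDist η x y)

variable {P η} in
/-- Induction along a chain of jumps whose total cost is less than `ε`. -/
theorem shortcutDist_induction {x y : P.Space} {ε : ℝ} (h : P.shortcutDist η x y < ε)
    {p : P.Space → Prop} (hx : p x)
    (step : ∀ u v, |P.height u - P.height x| < ε → p u → P.jumpCost η u v < ε → p v) : p y := by
  obtain ⟨_, ⟨n, c, -, rfl, rfl, rfl⟩, hs⟩ :=
    exists_lt_of_csInf_lt (P.shortcutDist_nonempty η x y) h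
  have hnn : ∀ i, 0 ≤ P.jumpCost η (c i) (c (i + 1)) := fun i => P.jumpCost_nonneg η _ _
  have hmono : ∀ m ≤ n, ∑ i ∈ Finset.range m, P.jumpCost η (c i) (c (i + 1)) < ε := fun m hm =>
    (Finset.sum_le_sum_of_subset_of_nonneg (Finset.range_mono hm) fun i _ _ => hnn i).trans_lt hs
  have key : ∀ m ≤ n, p (c m) ∧ |P.height (c m) - P.height (c 0)| ≤
      ∑ i ∈ Finset.range m, P.jumpCost η (c i) (c (i + 1)) := by
    intro m
    induction m with
    | zero => exact fun _ => ⟨hx, by simp⟩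
    | succ m ih =>
      intro hm
      obtain ⟨hp, hh⟩ := ih (by omega)
      have hsum := hmono (m + 1) hm
      rw [Finset.sum_range_succ] at hsum ⊢
      have h0 := (abs_nonneg _).trans hh
      refine ⟨step _ _ (hh.trans_lt (hmono m (by omega))) hp (by linarith), ?_⟩
      have h1 := P.abs_height_sub_le_jumpCost η (c m) (c (m + 1))
      rw [abs_sub_comm] at h1
      linarith [abs_sub_le (P.height (c (m + 1))) (P.height (c m)) (P.height (c 0))]
  exact (key n le_rfl).1

theorem abs_height_sub_le_shortcutDist (x y : P.Space) :
    |P.height x - P.height y| ≤ P.shortcutDist η x y := by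
  refine le_csInf (P.shortcutDist_nonempty η x y) ?_
  rintro _ ⟨n, c, -, rfl, rfl, rfl⟩
  rw [← Real.dist_eq]
  refine (dist_le_range_sum_dist (fun i => P.height (c i)) n).trans ?_
  exact Finset.sum_le_sum fun i _ => P.abs_height_sub_le_jumpCost η _ _

/-- Distinct points of equal height differ in some digit `i` at a height that is not a wormhole of
index `i`. With a gap `ε` to those wormholes, a chain of cost below `η i * (ε / 2)` stays `ε / 2`
away from them and cannot afford a shortcut changing digit `i` either. -/
theorem eq_of_shortcutDist_eq_zero {x y : P.Space} (h : P.shortcutDist η x y = 0) : x = y := by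
  have hh := P.abs_height_sub_le_shortcutDist η x y
  rw [h] at hh
  have hh : P.height x = P.height y := sub_eq_zero.1 (abs_nonpos_iff.1 hh)
  obtain ⟨⟨s, a⟩, rfl⟩ := Quot.exists_rep x
  obtain ⟨⟨t, b⟩, rfl⟩ := Quot.exists_rep y
  obtain rfl : s = t := Subtype.ext hh
  by_contra hne
  -- Otherwise the height is a wormhole height for every differing index; these sets being disjoint,
  -- only one digit differs and the points are identified.
  obtain ⟨i, hi, hW⟩ : ∃ i, a i ≠ b i ∧ (s : ℝ) ∉ P.wormholeHeights i := by
    by_contra hcon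
    push Not at hcon
    refine hne (Quot.sound ?_)
    by_cases hab : a = b
    · left
      rw [hab]
    · obtain ⟨i, hi⟩ := Function.ne_iff.1 hab
      refine Or.inr ⟨i, rfl, hcon i hi, fun j hj => ?_⟩
      by_contra hj'
      exact hj (P.wormholeHeights_disjoint (hcon j hj') (hcon i hi))
  obtain ⟨ε, hε, hball⟩ := Metric.isOpen_iff.1 (P.wormholeHeights_finite i).isClosed.isOpen_compl
    (s : ℝ) hW
  have hgap : ∀ w ∈ P.wormholeHeights i, ε ≤ |w - s| := fun w hw => by
    by_contra hlt
    exact hball (Metric.mem_ball.2 (not_le.1 hlt)) hw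
  have hη := (η i).2.1
  have hη1 := (η i).2.2
  have hlt : P.shortcutDist η (Quot.mk P.Rel (s, a)) (Quot.mk P.Rel (s, b)) < η i * (ε / 2) := by
    rw [h]
    positivity
  have hle : (η i : ℝ) * (ε / 2) ≤ ε / 2 := mul_le_of_le_one_left (by linarith) hη1
  have hmem : Quot.mk P.Rel (s, b) ∈ P.digitSet i (a i) := by
    refine shortcutDist_induction (p := (· ∈ P.digitSet i (a i))) hlt ⟨hW, rfl⟩ fun u v hu hp hc => ?_
    have hgap' : ∀ w ∈ P.wormholeHeights i, ε / 2 ≤ |w - P.height u| := fun w hw => by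
      have h1 := hgap w hw
      have h2 := abs_sub_le w (P.height u) s
      have h3 : |P.height u - s| < (η i : ℝ) * (ε / 2) := hu
      linarith
    rcases P.mem_digitSet_of_jumpCost_lt η hp hgap' (hc.trans_le hle) with h | ⟨S, -, -, -, h⟩
    · exact h
    · exact absurd (h _ hgap') (not_le.2 hc)
  exact hi hmem.2.symm

end LowerBounds

end LaaksoData

end

noncomputable section

namespace LaaksoData

/-! ### The height is Lipschitz light -/

section Light

variable (P : LaaksoData) (η : ℕ → Set.Ioc (0 : ℝ) 1)

/-- The digits of index less than `K` of `x` and `y` agree, except possibly those that can be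
changed at a wormhole with height in `I`. -/
def SameCell (K : ℕ) (I : Set ℝ) (x y : P.Space) : Prop :=
  ∀ i < K, Disjoint (P.wormholeHeights i) I → ∀ α, x ∈ P.digitSet i α ↔ y ∈ P.digitSet i α

variable {P} {K : ℕ} {I : Set ℝ}

theorem SameCell.refl (x : P.Space) : P.SameCell K I x x := fun _ _ _ _ => Iff.rfl

theorem SameCell.symm {x y : P.Space} (h : P.SameCell K I x y) : P.SameCell K I y x :=
  fun i hi hd α => (h i hi hd α).symm

theorem SameCell.trans {x y z : P.Space} (h : P.SameCell K I x y) (h' : P.SameCell K I y z) :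
    P.SameCell K I x z :=
  fun i hi hd α => (h i hi hd α).trans (h' i hi hd α)

theorem SameCell.digit_eq {s t : unitInterval} {a b : P.Digits}
    (h : P.SameCell K I (P.proj (s, a)) (P.proj (t, b))) (hs : (s : ℝ) ∈ I) {i : ℕ} (hi : i < K)
    (hd : Disjoint (P.wormholeHeights i) I) : a i = b i :=
  ((h i hi hd (a i)).1 ⟨fun hW => Set.disjoint_left.1 hd hW hs, rfl⟩).2.symm

variable (P) in
/-- A set of diameter less than `mesh K` contains at most one wormhole height of index less than
`K`. -/
theorem wormholeHeights_unique (hI : ∀ u ∈ I, ∀ v ∈ I, |u - v| < P.mesh K) {i j : ℕ} (hi : i < K)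
    (hj : j < K) {w w' : ℝ} (hw : w ∈ P.wormholeHeights i) (hw' : w' ∈ P.wormholeHeights j)
    (hwI : w ∈ I) (hwI' : w' ∈ I) : i = j := by
  have h := hI w hwI w' hwI'
  obtain ⟨m, rfl⟩ := P.wormholeHeights_eq_mul_mesh hi hw
  obtain ⟨m', rfl⟩ := P.wormholeHeights_eq_mul_mesh hj hw'
  obtain rfl := P.mul_mesh_injective h
  exact P.wormholeHeights_disjoint hw hw'

theorem laaksoDist_vertical_le (s t : unitInterval) (a : P.Digits) :
    P.laaksoDist (P.proj (s, a)) (P.proj (t, a)) ≤ |(s : ℝ) - t| :=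
  ENNReal.toReal_le_of_le_ofReal (abs_nonneg _) (P.laaksoEDist_vertical_le s t a)

/-- If a wormhole of index below `K` lies over `I`, a vertical move reaches it and corrects the one
digit that may differ. Then all digits of index below `K` agree and `laaksoDist_le_of_digits_eq`
applies. -/
theorem SameCell.shortcutDist_le (hI : ∀ u ∈ I, ∀ v ∈ I, |u - v| < P.mesh K) {x y : P.Space}
    (hx : P.height x ∈ I) (hy : P.height y ∈ I) (h : P.SameCell K I x y) :
    P.shortcutDist η x y ≤ 5 * P.mesh K := by
  obtain ⟨⟨s, a⟩, rfl⟩ := Quot.exists_rep x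
  obtain ⟨⟨t, b⟩, rfl⟩ := Quot.exists_rep y
  have hs : (s : ℝ) ∈ I := hx
  have ht : (t : ℝ) ∈ I := hy
  have hpos := P.mesh_pos K
  by_cases hW : ∃ i < K, ∃ w ∈ P.wormholeHeights i, w ∈ I
  · obtain ⟨i, hi, w, hw, hwI⟩ := hW
    have heq : ∀ j < K, j ≠ i → a j = b j := fun j hj hji =>
      h.digit_eq hs hj (Set.disjoint_left.2 fun w' hw' hwI' =>
        hji (P.wormholeHeights_unique hI hj hi hw' hw hwI' hwI))
    let w₀ : unitInterval := ⟨w, P.wormholeHeights_subset_unitInterval hw⟩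
    let a' : P.Digits := fun j => if j = i then b j else a j
    have hproj : P.proj (w₀, a) = P.proj (w₀, a') :=
      Quot.sound (Or.inr ⟨i, rfl, hw, fun j hj => by simp [a', hj]⟩)
    refine (P.shortcutDist_triangle η _ (P.proj (w₀, a)) _).trans ?_
    have h1 := (P.shortcutDist_le_laaksoDist η _ _).trans (laaksoDist_vertical_le s w₀ a)
    have h2 := (P.shortcutDist_le_laaksoDist η _ _).trans
      (P.laaksoDist_le_of_digits_eq (n := K) (s := w₀) (t := t) (a := a') (b := b) fun j hj => by
        by_cases hji : j = i
        · simp [a', hji]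
        · simp [a', hji, heq j hj hji])
    rw [← hproj] at h2
    have h3 : |(s : ℝ) - w₀| < P.mesh K := hI _ hs _ hwI
    have h4 : |(w₀ : ℝ) - t| < P.mesh K := hI _ hwI _ ht
    exact (add_le_add h1 h2).trans (by linarith)
  · have heq : ∀ j < K, a j = b j := fun j hj =>
      h.digit_eq hs hj (Set.disjoint_left.2 fun w' hw' hwI' => hW ⟨j, hj, w', hw', hwI'⟩)
    have h1 := (P.shortcutDist_le_laaksoDist η _ _).trans
      (P.laaksoDist_le_of_digits_eq (s := s) (t := t) heq)
    have h2 := hI _ hs _ ht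
    exact h1.trans (by linarith)

variable (P) in
/-- `y` is in the cell of `x`, or in that of a point which can be reached from the cell of `x` by a
shortcut of cost comparable to at most `r`. -/
def Reachable (K : ℕ) (I : Set ℝ) (r : ℝ) (x y : P.Space) : Prop :=
  P.SameCell K I x y ∨ ∃ i < K, ∃ S ∈ P.shortcuts i, η i * P.mesh (i + 1) ≤ 4 * r ∧
    ∃ p ∈ S, ∃ q ∈ S, P.height p ∈ I ∧ P.SameCell K I x p ∧ P.SameCell K I q y

theorem jumpCost_le_of_mem_shortcuts {C : ℝ} (hC : ∀ n, P.mesh n ≤ C * P.mesh (n + 1)) {i : ℕ}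
    {S : Set P.Space} (hS : S ∈ P.shortcuts i) {p q : P.Space} (hp : p ∈ S) (hq : q ∈ S) :
    P.jumpCost η p q ≤ 3 * C * (η i * P.mesh (i + 1)) := by
  rw [P.jumpCost_of_mem_shortcuts η hS hp hq]
  obtain ⟨t, -, e, rfl⟩ := hS
  obtain ⟨⟨s, a⟩, ha, rfl⟩ := hp
  obtain ⟨⟨s', b⟩, hb, rfl⟩ := hq
  have h := P.laaksoDist_le_of_digits_eq (s := s) (t := s') (a := a) (b := b) (n := i)
    fun j hj => (ha.2.1 j hj).trans (hb.2.1 j hj).symm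
  have hss : (s : ℝ) - s' = 0 := sub_eq_zero.2 (ha.1.trans hb.1.symm)
  rw [hss, abs_zero, zero_add] at h
  have h' : P.laaksoDist (P.proj (s, a)) (P.proj (s', b)) ≤ 3 * (C * P.mesh (i + 1)) :=
    h.trans (mul_le_mul_of_nonneg_left (hC i) (by norm_num))
  exact (mul_le_mul_of_nonneg_left h' (η i).2.1.le).trans (le_of_eq (by ring))

theorem Reachable.shortcutDist_le {C r : ℝ} (hC0 : 0 < C)
    (hC : ∀ n, P.mesh n ≤ C * P.mesh (n + 1)) (hI : ∀ u ∈ I, ∀ v ∈ I, |u - v| < P.mesh K)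
    {x y : P.Space} (hx : P.height x ∈ I) (hy : P.height y ∈ I) (hr : 0 < r)
    (h : P.Reachable η K I r x y) : P.shortcutDist η x y ≤ 10 * P.mesh K + 12 * C * r := by
  have hpos := P.mesh_pos K
  rcases h with h | ⟨i, -, S, hS, hcost, p, hp, q, hq, hpI, hxp, hqy⟩
  · have := h.shortcutDist_le η hI hx hy
    have : 0 ≤ 12 * C * r := by positivity
    linarith
  · have hqI : P.height q ∈ I := (P.height_of_mem_shortcuts hS hp hq).1 ▸ hpI
    have h1 := hxp.shortcutDist_le η hI hx hpI
    have h2 := hqy.shortcutDist_le η hI hqI hy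
    have h3 := (P.shortcutDist_le_jumpCost η p q).trans
      (jumpCost_le_of_mem_shortcuts η hC hS hp hq)
    have h4 : 3 * C * (η i * P.mesh (i + 1)) ≤ 3 * C * (4 * r) :=
      mul_le_mul_of_nonneg_left hcost (by positivity)
    have h5 := P.shortcutDist_triangle η x p y
    have h6 := P.shortcutDist_triangle η p q y
    linarith

/-- A jump of cost below `2 * r` cannot leave `I`, so a digit without wormholes over `I` changes
only by a shortcut of its own index. Such a change costs at least `η i * mesh (i + 1) / 2`, whence
the bound `4 * r`. -/
theorem sameCell_or_shortcut {r : ℝ} {p q : P.Space}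
    (hI : ∀ u, |u - P.height p| < 2 * r → u ∈ I) (hr : 0 < r) (h : P.jumpCost η p q < 2 * r) :
    P.SameCell K I p q ∨
      ∃ i < K, ∃ S ∈ P.shortcuts i, p ∈ S ∧ q ∈ S ∧ η i * P.mesh (i + 1) ≤ 4 * r := by
  rw [or_iff_not_imp_right]
  intro hno i hi hd α
  have hpI : P.height p ∈ I := hI _ (by simpa using hr)
  obtain ⟨β, hβ⟩ := exists_mem_digitSet fun hW => Set.disjoint_left.1 hd hW hpI
  have hgap : ∀ w ∈ P.wormholeHeights i, 2 * r ≤ |w - P.height p| := fun w hw => by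
    by_contra hlt
    exact Set.disjoint_left.1 hd hw (hI w (not_le.1 hlt))
  rcases P.mem_digitSet_of_jumpCost_lt η hβ hgap h with hq | ⟨S, hS, hpS, hqS, hL⟩
  · constructor <;> intro hα
    · rwa [digitSet_unique hα hβ]
    · rwa [digitSet_unique hα hq]
  · refine absurd ⟨i, hi, S, hS, hpS, hqS, ?_⟩ hno
    have := hL _ fun w hw =>
      P.half_mesh_le_abs_sub (P.height_of_mem_shortcuts hS hpS hqS).2 hw
    linarith

/-- Two shortcuts of index less than `K` with points in the same cell coincide. -/
theorem shortcuts_eq_of_sameCell (hI : ∀ u ∈ I, ∀ v ∈ I, |u - v| < P.mesh (K + 1)) {i j : ℕ}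
    (hi : i < K) (hj : j < K) {S T : Set P.Space} (hS : S ∈ P.shortcuts i)
    (hT : T ∈ P.shortcuts j) {p q : P.Space} (hp : p ∈ S) (hq : q ∈ T) (hpI : P.height p ∈ I)
    (hqI : P.height q ∈ I) (h : P.SameCell K I p q) : S = T := by
  have hpW := P.shortcutHeights_subset (P.height_of_mem_shortcuts hS hp hp).2
  have hqW := P.shortcutHeights_subset (P.height_of_mem_shortcuts hT hq hq).2
  -- Both heights are wormhole heights, of indices `i + 1` and `j + 1` below `K + 1`, and `I` has
  -- room for one.
  obtain rfl : i = j := by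
    have := P.wormholeHeights_unique hI (by omega) (by omega) hpW hqW hpI hqI
    omega
  have hpq : P.height p = P.height q := by
    have hd := hI _ hpI _ hqI
    obtain ⟨m, hm⟩ := P.wormholeHeights_eq_mul_mesh (n := K + 1) (by omega) hpW
    obtain ⟨m', hm'⟩ := P.wormholeHeights_eq_mul_mesh (n := K + 1) (by omega) hqW
    rw [hm, hm'] at hd ⊢
    rw [P.mul_mesh_injective hd]
  -- That single height has index `i + 1`, so the digits of index below `i`, which determine the
  -- shortcut, are constant on the cell.
  have hdisj : ∀ k < i, Disjoint (P.wormholeHeights k) I := fun k hk =>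
    Set.disjoint_left.2 fun w hw hwI => by
      have := P.wormholeHeights_unique hI (by omega) (by omega) hw hpW hwI hpI
      omega
  obtain ⟨t, -, a, rfl⟩ := hS
  obtain ⟨t', -, b, rfl⟩ := hT
  obtain ⟨⟨s, x⟩, hx, rfl⟩ := hp
  obtain ⟨⟨s', y⟩, hy, rfl⟩ := hq
  obtain rfl : t = t' := hx.1.symm.trans (hpq.trans hy.1)
  have hab : ∀ k < i, a k = b k := fun k hk =>
    (hx.2.1 k hk).symm.trans ((h.digit_eq hpI (hk.trans hi) (hdisj k hk)).trans (hy.2.1 k hk))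
  congr 1
  ext z
  refine and_congr_right fun _ => and_congr_left fun _ => forall₂_congr fun k hk => ?_
  rw [hab k hk]

/-- After one shortcut, a second one must be the same shortcut again, so its endpoint is reached
directly from the first entry point. This makes the bound independent of the length of the chain. -/
theorem Reachable.jump {r : ℝ} (hI : ∀ u ∈ I, ∀ v ∈ I, |u - v| < P.mesh (K + 1)) (hr : 0 < r)
    {x y z : P.Space} (hyI : ∀ u, |u - P.height y| < 2 * r → u ∈ I)
    (h : P.Reachable η K I r x y) (hyz : P.jumpCost η y z < 2 * r) :
    P.Reachable η K I r x z := by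
  have hy : P.height y ∈ I := hyI _ (by simpa using hr)
  rcases sameCell_or_shortcut (K := K) η hyI hr hyz with hs | ⟨j, hj, T, hT, hyT, hzT, hcost⟩
  · rcases h with h | ⟨i, hi, S, hS, hc, p, hp, q, hq, hpI, hxp, hqy⟩
    · exact Or.inl (h.trans hs)
    · exact Or.inr ⟨i, hi, S, hS, hc, p, hp, q, hq, hpI, hxp, hqy.trans hs⟩
  · rcases h with h | ⟨i, hi, S, hS, hc, p, hp, q, hq, hpI, hxp, hqy⟩
    · exact Or.inr ⟨j, hj, T, hT, hcost, y, hyT, z, hzT, hy, h, SameCell.refl z⟩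
    · have hqI : P.height q ∈ I := (P.height_of_mem_shortcuts hS hp hq).1 ▸ hpI
      obtain rfl := shortcuts_eq_of_sameCell hI hi hj hS hT hq hyT hqI hy hqy
      exact Or.inr ⟨i, hi, S, hS, hc, p, hp, z, hzT, hpI, hxp, SameCell.refl z⟩

variable (P) in
theorem isLipschitzLight_shortcutHeight : IsLipschitzLight (P.shortcutHeight η) := by
  obtain ⟨C, hC0, hC⟩ := P.exists_mesh_le
  -- At large scales the whole space has diameter at most `4 ≤ 40 * C * r`. Otherwise `10 * mesh K +
  -- 12 * C * r` is at most `(100 * C ^ 2 + 12 * C) * r`. The constant covers both cases.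
  have key : ∀ (E : Set ℝ) (r : ℝ), 0 < r → Metric.ediam E ≤ ENNReal.ofReal r →
      ∀ x ∈ P.shortcutHeight η ⁻¹' E, ∀ y ∈ rComponent (P.shortcutHeight η ⁻¹' E) r x,
        dist x y ≤ (1 + 52 * C + 100 * C ^ 2) * r := by
    intro E r hr hE x hx y hy
    by_cases hlarge : P.mesh 1 ≤ 10 * r
    · obtain ⟨⟨s, a⟩, rfl⟩ := Quot.exists_rep x
      obtain ⟨⟨t, b⟩, rfl⟩ := Quot.exists_rep y
      have h1 : dist (α := P.ShortcutSpace η) (Quot.mk P.Rel (s, a)) (Quot.mk P.Rel (t, b)) ≤ _ :=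
        (P.shortcutDist_le_laaksoDist η _ _).trans
          (P.laaksoDist_le_of_digits_eq (n := 0) (s := s) (t := t) (a := a) (b := b) (by simp))
      have h2 : |(s : ℝ) - t| ≤ 1 := by
        rw [abs_le]
        constructor <;> linarith [s.2.1, s.2.2, t.2.1, t.2.2]
      have h3 : P.mesh 0 ≤ C * (10 * r) := (hC 0).trans (mul_le_mul_of_nonneg_left hlarge hC0.le)
      rw [P.mesh_zero] at h1 h3
      have h4 : 0 < C * r := by positivity
      have h5 : 0 < C ^ 2 * r := by positivity
      exact h1.trans (by linarith)
    have hex : ∃ k, P.mesh (k + 1) ≤ 10 * r :=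
      ((P.mesh_tendsto.comp (Filter.tendsto_add_atTop_nat 1)).eventually
        (gt_mem_nhds (by positivity : 0 < 10 * r))).exists.imp fun k hk => le_of_lt hk
    classical
    obtain ⟨K, hK⟩ : ∃ K, Nat.find hex = K + 1 := by
      refine Nat.exists_eq_succ_of_ne_zero fun h0 => hlarge ?_
      have := Nat.find_spec hex
      rwa [h0] at this
    have hK1 : P.mesh (K + 2) ≤ 10 * r := by
      have := Nat.find_spec hex
      rwa [hK] at this
    have hK0 : 10 * r < P.mesh (K + 1) := not_le.1 (Nat.find_min hex (by omega))
    -- Radius `5 * r`: `r` for the points of the component, `2 * r` for the intermediate points of a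
    -- chain realising one step, which may leave the preimage of `E`, and `2 * r` for a single jump.
    let I : Set ℝ := {u | |u - P.height x| < 5 * r}
    have hI : ∀ u ∈ I, ∀ v ∈ I, |u - v| < P.mesh (K + 1) := fun u hu v hv => by
      have h1 : |u - P.height x| < 5 * r := hu
      have h2 : |v - P.height x| < 5 * r := hv
      have h3 := abs_sub_le u (P.height x) v
      rw [abs_sub_comm (P.height x) v] at h3
      linarith
    have hEdist : ∀ p ∈ P.shortcutHeight η ⁻¹' E, |P.height p - P.height x| ≤ r := fun p hp => by
      have h := (Metric.edist_le_ediam_of_mem (s := E) (x := P.height p) hp hx).trans hE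
      rw [edist_dist, ENNReal.ofReal_le_ofReal_iff hr.le] at h
      exact h
    have hreach : ∀ z, Relation.ReflTransGen (fun p q => p ∈ P.shortcutHeight η ⁻¹' E ∧
        q ∈ P.shortcutHeight η ⁻¹' E ∧ dist p q ≤ r) x z → P.Reachable η K I r x z := by
      intro z hz
      induction hz with
      | refl => exact Or.inl (SameCell.refl x)
      | @tail p q _ hpq ih =>
        obtain ⟨hp, -, hd⟩ := hpq
        have hd' : P.shortcutDist η p q < 2 * r := lt_of_le_of_lt hd (by linarith)
        refine shortcutDist_induction hd' ih fun u v hu hru huv =>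
          hru.jump η hI hr (fun t ht => ?_) huv
        have h1 := hEdist p hp
        have h2 := abs_sub_le t (P.height u) (P.height x)
        have h3 := abs_sub_le (P.height u) (P.height p) (P.height x)
        change |t - P.height x| < 5 * r
        linarith
    have hxI : P.height x ∈ I := by
      change |P.height x - P.height x| < 5 * r
      simpa using hr
    have hyI : P.height y ∈ I :=
      lt_of_le_of_lt (hEdist y (rComponent_subset hy)) (by linarith)
    have hI' : ∀ u ∈ I, ∀ v ∈ I, |u - v| < P.mesh K := fun u hu v hv =>
      (hI u hu v hv).trans (P.mesh_strictAnti (Nat.lt_succ_self K))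
    have h1 : dist x y ≤ _ := (hreach y (mem_rComponent_iff.1 hy).2).shortcutDist_le η
      hC0 hC hI' hxI hyI hr
    have h2 : P.mesh K ≤ C * (C * (10 * r)) :=
      (hC K).trans (mul_le_mul_of_nonneg_left
        ((hC (K + 1)).trans (mul_le_mul_of_nonneg_left hK1 hC0.le)) hC0.le)
    have h3 : 0 < C * r := by positivity
    linarith
  have hC1 : (1 : ℝ) ≤ 2 * (1 + 52 * C + 100 * C ^ 2) := by nlinarith
  refine ⟨2 * (1 + 52 * C + 100 * C ^ 2), by positivity, fun x y => ?_, fun E r hr hE x hx => ?_⟩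
  · have h1 : dist (P.shortcutHeight η x) (P.shortcutHeight η y) ≤ dist x y :=
      P.abs_height_sub_le_shortcutDist η x y
    exact h1.trans (le_mul_of_one_le_left dist_nonneg hC1)
  · refine Metric.ediam_le fun y hy z hz => ?_
    rw [edist_dist]
    refine ENNReal.ofReal_le_ofReal ?_
    have h1 := key E r hr hE x hx y hy
    have h2 := key E r hr hE x hx z hz
    have h3 := dist_triangle_left y z x
    linarith

end Light

/-! ### Topology of the shortcut space -/

section Topology

variable (P : LaaksoData) (η : ℕ → Set.Ioc (0 : ℝ) 1)

/-- The identity from the Laakso space with the quotient topology to the shortcut space. -/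
def toShortcutSpace : P.Space → P.ShortcutSpace η := id

/-- Near a point of the cover many digits agree and the heights are close, so
`laaksoDist_le_of_digits_eq` gives continuity. Compactness and connectedness of the shortcut space
both follow from this map. -/
theorem continuous_toShortcutSpace : Continuous (P.toShortcutSpace η) := by
  refine continuous_coinduced_dom.2 (continuous_iff_continuousAt.2 ?_)
  rintro ⟨s, a⟩
  refine tendsto_iff_dist_tendsto_zero.2 ?_
  rw [Metric.tendsto_nhds]
  intro ε hε
  obtain ⟨n, hn⟩ := (P.mesh_tendsto.eventually
    (gt_mem_nhds (by positivity : 0 < ε / 6))).exists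
  have h1 : ∀ᶠ z : P.Cover in nhds (s, a), ∀ j < n, z.2 j = a j :=
    (continuous_snd.tendsto (s, a)).eventually (P.eventually_digits_eq a n)
  have h2 : ∀ᶠ z : P.Cover in nhds (s, a), dist z.1 s < ε / 2 :=
    (continuous_fst.tendsto (s, a)).eventually (Metric.ball_mem_nhds s (by positivity))
  filter_upwards [h1, h2] with z hz1 hz2
  have h3 := (P.shortcutDist_le_laaksoDist η _ _).trans
    (P.laaksoDist_le_of_digits_eq (s := z.1) (t := s) hz1)
  rw [Real.dist_0_eq_abs, abs_of_nonneg dist_nonneg]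
  have h4 : |(z.1 : ℝ) - s| < ε / 2 := hz2
  refine lt_of_le_of_lt h3 ?_
  linarith

instance : CompactSpace (P.ShortcutSpace η) := by
  refine ⟨?_⟩
  have h := isCompact_range ((P.continuous_toShortcutSpace η).comp P.continuous_proj)
  exact h.of_isClosed_subset isClosed_univ fun x _ => Quot.exists_rep x

instance : PreconnectedSpace (P.ShortcutSpace η) := by
  refine ⟨isPreconnected_of_forall_pair fun x _ y _ => ?_⟩
  obtain ⟨γ, hγ, h0, h1, -⟩ := P.exists_curve (P.laaksoEDist_ne_top x y).lt_top
  exact ⟨Set.range (P.toShortcutSpace η ∘ P.proj ∘ γ), Set.subset_univ _, ⟨0, h0⟩, ⟨1, h1⟩,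
    isPreconnected_range ((P.continuous_toShortcutSpace η).comp hγ)⟩

theorem exists_dist_ne_zero : ∃ x y : P.ShortcutSpace η, dist x y ≠ 0 := by
  let a : P.Digits := fun _ => P.letterOne
  refine ⟨P.proj (0, a), P.proj (1, a), fun h => ?_⟩
  have h1 := P.abs_height_sub_le_shortcutDist η (P.proj (0, a)) (P.proj (1, a))
  have h2 : P.shortcutDist η (P.proj (0, a)) (P.proj (1, a)) = 0 := h
  rw [h2] at h1
  have h3 : |(0 : ℝ) - 1| ≤ 0 := h1
  norm_num at h3

end Topology

end LaaksoData

end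

theorem mainTheorem10 (P : LaaksoData) (η : ℕ → Set.Ioc (0 : ℝ) 1) :
    (∀ x y : P.ShortcutSpace η, dist x y = 0 → x = y) ∧
    topologicalDim (P.ShortcutSpace η) = 1 ∧
    nagataDim (P.ShortcutSpace η) = 1 ∧
    lipschitzDim (P.ShortcutSpace η) = 1 ∧
    IsLipschitzLight (P.shortcutHeight η) := by
  obtain ⟨x, y, hxy⟩ := P.exists_dist_ne_zero η
  have hlight := P.isLipschitzLight_shortcutHeight η
  have hN := nagataDim_le_one_of_isLipschitzLight hlight
  exact ⟨fun x y h => P.eq_of_shortcutDist_eq_zero η h,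
    le_antisymm (topologicalDim_le_nagataDim.trans hN) (one_le_topologicalDim hxy),
    le_antisymm hN (one_le_nagataDim hxy),
    le_antisymm (lipschitzDim_le_one_of_isLipschitzLight hlight) (one_le_lipschitzDim hxy),
    hlight⟩
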